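/- Let $n\ge 1$ be an integer. There are constants $c(n)\in(0,1)$ and $C(n)>0$, depending only on $n$, with the following property. Let $r_0>0$ and let $u:B_{r_0}(0)\subset\mathbb{R}^2=\mathbb{C}\to\mathbb{R}$ be a non-constant harmonic function with $u(0)=0$ that has a boundary value in $L^1$: there is an integrable function $g$ on the circle $\partial B_{r_0}(0)$ with $$\int_0^{2\pi}\big|u(re^{i\theta})-g(r_0e^{i\theta})\big|\,d\theta\to 0\qquad (r\to r_0^-).$$ Call a nodal curve of $u$ any maximal real-analytic curve, parametrized by arc length on an open interval, in the nodal set $Z(u)=\{z\in B_{r_0}(0): u(z)=0\}$. Assume that $u$ has only $n$ nodal curves in $B_{r_0}(0)$ and that they intersect at $0$, i.e. $Z(u)$ is the union of $n$ distinct nodal curves, each passing through $0$. Then for every $z\in (Z(u)\setminus\{0\})\cap B_{c(n)r_0}(0)$ we have $\nabla u(z)\neq 0$, and $$|\kappa(u)(z)|\le \frac{C(n)}{r_0},\qquad \kappa(u)=\frac{-u_y^2u_{xx}+2u_xu_yu_{xy}-u_x^2u_{yy}}{(u_x^2+u_y^2)^{3/2}};$$ in particular the curvature at $z$ of every nodal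 curve of $u$ passing through $z$ is at most $C(n)/r_0$ in absolute value. -/

import Mathlib

open Set Filter Topology

noncomputable section

/-- `u` has the integrable function `g` as its boundary value on the circle of radius `R` about `0`:
the traces of `u` on the circles of radius `r < R` converge to `g` in `L¹` as `r → R`. -/
def HasL1BoundaryValue (u g : ℂ → ℝ) (R : ℝ) : Prop :=
  CircleIntegrable g 0 R ∧
    Tendsto (fun r : ℝ => ∫ θ in (0 : ℝ)..(2 * Real.pi),
      |u (circleMap 0 r θ) - g (circleMap 0 R θ)|) (𝓝[<] R) (𝓝 0)

/-- The nodal set of `u` in `Ω`. -/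
def nodalSet (u : ℂ → ℝ) (Ω : Set ℂ) : Set ℂ := {z | z ∈ Ω ∧ u z = 0}

/-- A real-analytic curve, parametrized by arc length on a nonempty open interval `I`, that lies in
the nodal set of `u` in `Ω`. -/
structure IsNodalArc (u : ℂ → ℝ) (Ω : Set ℂ) (I : Set ℝ) (γ : ℝ → ℂ) : Prop where
  isOpen : IsOpen I
  ordConnected : I.OrdConnected
  nonempty : I.Nonempty
  analytic : AnalyticOnNhd ℝ γ I
  unit_speed : ∀ t ∈ I, ‖deriv γ t‖ = 1
  mapsTo : MapsTo γ I (nodalSet u Ω)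

/-- A nodal curve of `u` in `Ω`: a maximal real-analytic curve in the nodal set, that is, one that
has no extension to a larger open interval. -/
structure IsNodalCurve (u : ℂ → ℝ) (Ω : Set ℂ) (I : Set ℝ) (γ : ℝ → ℂ) : Prop
    extends IsNodalArc u Ω I γ where
  maximal : ∀ (J : Set ℝ) (δ : ℝ → ℂ), IsNodalArc u Ω J δ → I ⊆ J → EqOn γ δ I → J = I

/-- `u` has only `n` nodal curves in `Ω`, and they intersect at `p`: the nodal set of `u` in `Ω` is
composed of `n` distinct nodal curves, each of which passes through `p` (at parameter `0`).
Distinct curves are curves with distinct images. -/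
def HasOnlyNodalCurvesThrough (u : ℂ → ℝ) (Ω : Set ℂ) (p : ℂ) (n : ℕ) : Prop :=
  ∃ (I : Fin n → Set ℝ) (γ : Fin n → ℝ → ℂ),
    (∀ k, IsNodalCurve u Ω (I k) (γ k) ∧ (0 : ℝ) ∈ I k ∧ γ k 0 = p) ∧
    Function.Injective (fun k => γ k '' I k) ∧
    nodalSet u Ω = ⋃ k, γ k '' I k

/-- The partial derivative `∂u/∂x`, where `z = x + iy`. -/
def partialX (u : ℂ → ℝ) (z : ℂ) : ℝ := fderiv ℝ u z 1

/-- The partial derivative `∂u/∂y`, where `z = x + iy`. -/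
def partialY (u : ℂ → ℝ) (z : ℂ) : ℝ := fderiv ℝ u z Complex.I

/-- The curvature `κ(u)(z)` at `z` of the level curve of `u` through `z`, meaningful where the
gradient of `u` does not vanish. -/
def nodalCurvature (u : ℂ → ℝ) (z : ℂ) : ℝ :=
  (-(partialY u z) ^ 2 * partialX (partialX u) z
      + 2 * partialX u z * partialY u z * partialY (partialX u) z
      - (partialX u z) ^ 2 * partialY (partialY u) z) /
    (Real.sqrt ((partialX u z) ^ 2 + (partialY u z) ^ 2)) ^ 3

/-- The signed curvature `(x' y'' - y' x'') / (x'² + y'²)^(3/2)` of the plane curve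
`γ = x + iy` at the parameter `t`. -/
def curveCurvature (γ : ℝ → ℂ) (t : ℝ) : ℝ :=
  ((deriv γ t).re * (deriv (deriv γ) t).im - (deriv γ t).im * (deriv (deriv γ) t).re) /
    ‖deriv γ t‖ ^ 3

end

/-! Write `u = Re f` with `f` holomorphic, `f 0 = 0`, and let `a_k` be the Taylor coefficients of
`f`. The heart of the matter is the estimate `R^N |a_N| ≤ K^(N-n) R^n |a_n|` for `N ≥ n`, together
with `a_k = 0` for `k < n`, where `K` depends on `n` only (`taylorCoeff_bounds`). It gives `f = z^n
h` on the disc of radius `ρ = R/(2K)`, with `h` bounded by `2 |h 0|`. Close to `0`, `f` and its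
first two derivatives are then those of a monomial up to a relative error of order `|z|/ρ`. The zero
set of the real part of a monomial consists of straight lines, so the leading term of the curvature
cancels exactly where `u = 0`. What is left is of order `(|z|/ρ)/|z| = 1/ρ`
(`abs_re_mul_conj_sq_le`).

The coefficients below `n` vanish because `f` is locally the `m`-th power of a coordinate `φ`, and a
nodal curve is determined by its tangent at `0`, for which there are at most `m` possible lines.
Hence `n ≤ m`.

The coefficients above `n` are controlled through the boundary. Each of the `2n` half-branches
issuing from `0` either stays in a smaller disc or leaves every smaller disc for good
(`IsNodalArc.bounded_or_exits`). It can therefore serve only one sector between rays on which `u`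
has a definite sign, and the radial limits of `u`, which exist almost everywhere and equal `g` by
Fatou's theorem, change sign at most `2n` times (`not_alternating_radii`). Some trigonometric
polynomial `T` of degree `n` with unimodular roots thus makes `g T` nonnegative up to a constant
phase (`HasL1BoundaryValue.exists_unit_roots`).

Every Fourier coefficient of a nonnegative function is dominated by its mean. For `g T` each
coefficient is a combination of `2n + 1` consecutive coefficients of `g`; the mean involves only the
indices from `-n` to `n`, of which just `±n` survive. The remaining coefficients form a linear
recurrence with a controlled error, which yields the geometric bound (`le_geometric_of_recurrence`).
-/

/-! ### Local structure of the zero set of the real part of a holomorphic function. -/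

/-- Near a point where it is not locally constant, an analytic function minus its value is a power
of a local analytic coordinate. -/
theorem AnalyticAt.exists_pow_coordinate {f : ℂ → ℂ} {w : ℂ} (hf : AnalyticAt ℂ f w)
    (hnc : ¬ ∀ᶠ z in 𝓝 w, f z = f w) :
    ∃ (m : ℕ) (φ : ℂ → ℂ), 1 ≤ m ∧ AnalyticAt ℂ φ w ∧ φ w = 0 ∧ deriv φ w ≠ 0 ∧
      ∀ᶠ z in 𝓝 w, f z - f w = φ z ^ m := by
  have hF : AnalyticAt ℂ (fun z => f z - f w) w := hf.sub analyticAt_const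
  have hnc' : ¬ ∀ᶠ z in 𝓝 w, f z - f w = 0 := by simpa [sub_eq_zero] using hnc
  obtain ⟨m, F, hFa, hF0, hFe⟩ := hF.exists_eventuallyEq_pow_smul_nonzero_iff.mpr hnc'
  have hm : m ≠ 0 := by
    rintro rfl
    have := hFe.self_of_nhds
    simp at this
    exact hF0 this.symm
  have hmC : (m : ℂ) ≠ 0 := by exact_mod_cast hm
  -- An analytic `m`-th root of `F`: the quotient `F z / F w` is near `1`, where the principal
  -- logarithm is analytic.
  set G : ℂ → ℂ := fun z => (F w) ^ ((m : ℂ)⁻¹) * Complex.exp (Complex.log (F z / F w) / m) with hG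
  have hslit : F w / F w ∈ Complex.slitPlane := by simp [div_self hF0]
  have hGa : AnalyticAt ℂ G w :=
    analyticAt_const.mul
      ((((hFa.div analyticAt_const hF0).clog hslit).div analyticAt_const hmC).cexp)
  have hGw : G w ≠ 0 := by
    simp only [hG]
    exact mul_ne_zero (by simp [Complex.cpow_eq_zero_iff, hF0]) (Complex.exp_ne_zero _)
  have hne : ∀ᶠ z in 𝓝 w, F z ≠ 0 := hFa.continuousAt.eventually_ne hF0
  refine ⟨m, fun z => (z - w) * G z, Nat.one_le_iff_ne_zero.mpr hm,
    (analyticAt_id.sub analyticAt_const).mul hGa, by simp, ?_, ?_⟩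
  · have h1 : HasDerivAt (fun z => (z - w) * G z) (1 * G w + (w - w) * deriv G w) w :=
      ((hasDerivAt_id w).sub_const w).mul hGa.differentiableAt.hasDerivAt
    rw [h1.deriv]
    simpa using hGw
  · filter_upwards [hFe, hne] with z hz hz0
    rw [hz, smul_eq_mul, mul_pow]
    congr 1
    simp only [hG]
    rw [mul_pow, Complex.cpow_nat_inv_pow _ hm, ← Complex.exp_nat_mul,
      mul_div_cancel₀ _ hmC, Complex.exp_log (div_ne_zero hz0 hF0)]
    field_simp

/-- A differentiable curve through `0` with nonzero velocity whose `m`-th power is purely imaginary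
has constant direction, and the `m`-th power of that direction is purely imaginary. -/
theorem eventually_im_div_eq_zero_of_re_pow_eq_zero {q : ℝ → ℂ} {d : ℂ} {m : ℕ} (hm : 1 ≤ m)
    (hq0 : q 0 = 0) (hq : HasDerivAt q d 0) (hd : d ≠ 0) (hre : ∀ᶠ t in 𝓝 0, (q t ^ m).re = 0) :
    (d ^ m).re = 0 ∧ ∀ᶠ t in 𝓝 0, (q t / d).im = 0 := by
  have hm0 : m ≠ 0 := by omega
  have hy : Tendsto (fun t : ℝ => q t / (d * t)) (𝓝[≠] 0) (𝓝 1) := by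
    have h1 := (hasDerivAt_iff_tendsto_slope.mp hq).div_const d
    rw [div_self hd] at h1
    refine h1.congr fun t => ?_
    simp only [slope, hq0, sub_zero, vsub_eq_sub, Complex.real_smul, Complex.ofReal_inv]
    rw [mul_comm d, ← div_div, div_eq_inv_mul (q t)]
  have hym : Tendsto (fun t : ℝ => (q t / (d * t)) ^ m) (𝓝[≠] 0) (𝓝 1) := by simpa using hy.pow m
  -- With `y = q t / (d t)`, which tends to `1`, one has `q t ^ m = t ^ m * (d ^ m * y ^ m)`, and
  -- the real factor `t ^ m` can be dropped.
  have key : ∀ᶠ t : ℝ in 𝓝[≠] 0, (d ^ m * (q t / (d * t)) ^ m).re = 0 := by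
    filter_upwards [hre.filter_mono nhdsWithin_le_nhds, self_mem_nhdsWithin] with t ht ht0
    have ht0' : (t : ℂ) ≠ 0 := by exact_mod_cast ht0
    have e : q t ^ m = ((t ^ m : ℝ) : ℂ) * (d ^ m * (q t / (d * t)) ^ m) := by
      push_cast
      rw [← mul_pow, ← mul_pow]
      congr 1
      field_simp
    rw [e, Complex.re_ofReal_mul] at ht
    exact (mul_eq_zero.mp ht).resolve_left (pow_ne_zero _ ht0)
  have hdre : (d ^ m).re = 0 := by
    have h1 : Tendsto (fun t : ℝ => (d ^ m * (q t / (d * t)) ^ m).re) (𝓝[≠] 0)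
        (𝓝 (d ^ m * 1).re) :=
      (Complex.continuous_re.tendsto _).comp (tendsto_const_nhds.mul hym)
    have h2 := tendsto_nhds_unique (h1.congr' key) tendsto_const_nhds
    simpa using h2
  refine ⟨hdre, ?_⟩
  have hdim : (d ^ m).im ≠ 0 := fun h => pow_ne_zero m hd (Complex.ext hdre h)
  have hinj : ∃ U ∈ 𝓝 (1 : ℂ), InjOn (fun z : ℂ => z ^ m) U := by
    have h1 : HasStrictDerivAt (fun z : ℂ => z ^ m) ((m : ℂ) * 1 ^ (m - 1)) 1 :=
      hasStrictDerivAt_pow m 1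
    have h2 : ((m : ℂ) * 1 ^ (m - 1)) ≠ 0 := by simpa using hm0
    have h3 := h1.hasStrictFDerivAt_equiv h2
    refine ⟨(h3.toOpenPartialHomeomorph _).source, ?_, ?_⟩
    · exact (h3.toOpenPartialHomeomorph _).open_source.mem_nhds
        h3.mem_toOpenPartialHomeomorph_source
    · exact (h3.toOpenPartialHomeomorph _).injOn
  obtain ⟨U, hU, hUi⟩ := hinj
  have hnorm : Tendsto (fun t : ℝ => ((‖q t / (d * t)‖ : ℝ) : ℂ)) (𝓝[≠] 0) (𝓝 1) := by
    have := (Complex.continuous_ofReal.tendsto _).comp hy.norm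
    rwa [norm_one, Complex.ofReal_one] at this
  have hpos : ∀ᶠ t : ℝ in 𝓝[≠] 0, 0 < ((q t / (d * t)) ^ m).re := by
    have := ((Complex.continuous_re.tendsto _).comp hym)
    exact this.eventually (lt_mem_nhds (by simp))
  have hmain : ∀ᶠ t : ℝ in 𝓝[≠] 0, (q t / d).im = 0 := by
    filter_upwards [key, hy hU, hnorm hU, hpos, self_mem_nhdsWithin] with t hk h1 h2 h3 h4
    -- As `d ^ m` is purely imaginary and nonzero, `y ^ m` is real, and positive near `1`. Hence `y`
    -- and `‖y‖` have the same `m`-th power, and both lie where that power is injective, so `y` is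
    -- real.
    set y := q t / (d * t) with hydef
    have him : (y ^ m).im = 0 := by
      rw [Complex.mul_re, hdre, zero_mul, zero_sub, neg_eq_zero] at hk
      exact (mul_eq_zero.mp hk).resolve_left hdim
    have hym' : y ^ m = ((‖y‖ : ℝ) : ℂ) ^ m := by
      have e1 : y ^ m = (((y ^ m).re : ℝ) : ℂ) := Complex.ext (by simp) (by simp [him])
      have e2 : ‖y‖ ^ m = (y ^ m).re := by
        rw [← norm_pow, e1, Complex.norm_real, Complex.ofReal_re, Real.norm_of_nonneg h3.le]
      rw [e1, ← Complex.ofReal_pow, e2]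
    have hyr : y = ((‖y‖ : ℝ) : ℂ) := hUi h1 h2 hym'
    have ht0' : (t : ℂ) ≠ 0 := by exact_mod_cast h4
    have e : q t / d = t * y := by rw [hydef]; field_simp
    rw [e, hyr, ← Complex.ofReal_mul, Complex.ofReal_im]
  rw [eventually_nhdsWithin_iff] at hmain
  filter_upwards [hmain] with t ht
  by_cases h0 : t = 0
  · simp [h0, hq0]
  · exact ht h0

theorem hasDerivAt_comp_real {f : ℂ → ℂ} {γ : ℝ → ℂ} {t : ℝ} (hf : DifferentiableAt ℂ f (γ t))
    (hγ : DifferentiableAt ℝ γ t) :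
    HasDerivAt (fun s => f (γ s)) (deriv f (γ t) * deriv γ t) t :=
  hf.hasDerivAt.comp_of_eq t hγ.hasDerivAt rfl

/-- Two unit-speed analytic curves in the zero set of `Re f` that pass through the same point with
the same velocity coincide near that point. -/
theorem eventuallyEq_of_re_eq_zero_of_deriv_eq {f : ℂ → ℂ} {w : ℂ} (hf : AnalyticAt ℂ f w)
    (hre : (f w).re = 0) (hnc : ¬ ∀ᶠ z in 𝓝 w, f z = f w) {γ₁ γ₂ : ℝ → ℂ}
    (a₁ : AnalyticAt ℝ γ₁ 0) (a₂ : AnalyticAt ℝ γ₂ 0) (h₁ : γ₁ 0 = w) (h₂ : γ₂ 0 = w)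
    (s₁ : ∀ᶠ t in 𝓝 0, ‖deriv γ₁ t‖ = 1) (s₂ : ∀ᶠ t in 𝓝 0, ‖deriv γ₂ t‖ = 1)
    (z₁ : ∀ᶠ t in 𝓝 0, (f (γ₁ t)).re = 0) (z₂ : ∀ᶠ t in 𝓝 0, (f (γ₂ t)).re = 0)
    (hd : deriv γ₁ 0 = deriv γ₂ 0) : γ₁ =ᶠ[𝓝 0] γ₂ := by
  obtain ⟨m, φ, hm, hφ, hφw, hφ', hpow⟩ := hf.exists_pow_coordinate hnc
  set d : ℂ := deriv φ w * deriv γ₁ 0 with hddef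
  have hγ0 : deriv γ₁ 0 ≠ 0 := by
    have := s₁.self_of_nhds
    intro h
    simp [h] at this
  have hd0 : d ≠ 0 := mul_ne_zero hφ' hγ0
  -- In the coordinate `φ` either curve runs along the same real line through `0`, with an analytic
  -- real position `x`.
  have line : ∀ γ : ℝ → ℂ, AnalyticAt ℝ γ 0 → γ 0 = w → (∀ᶠ t in 𝓝 0, (f (γ t)).re = 0) →
      deriv γ 0 = deriv γ₁ 0 → ∃ x : ℝ → ℝ, AnalyticAt ℝ x 0 ∧ x 0 = 0 ∧ HasDerivAt x 1 0 ∧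
        ∀ᶠ t in 𝓝 0, φ (γ t) = d * x t := by
    intro γ ha h0 hz hdd
    have hder : HasDerivAt (fun t => φ (γ t)) d 0 := by
      have := hasDerivAt_comp_real (f := φ) (γ := γ) (t := 0)
        (by rw [h0]; exact hφ.differentiableAt) ha.differentiableAt
      rwa [h0, hdd] at this
    have hzz : ∀ᶠ t in 𝓝 (0 : ℝ), ((φ (γ t)) ^ m).re = 0 := by
      have hc : Tendsto γ (𝓝 0) (𝓝 w) := by
        have := ha.continuousAt
        rwa [ContinuousAt, h0] at this
      filter_upwards [hz, hc.eventually hpow] with t h1 h2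
      rw [← h2, Complex.sub_re, h1, hre, sub_zero]
    have him := (eventually_im_div_eq_zero_of_re_pow_eq_zero hm (by rw [h0, hφw]) hder hd0 hzz).2
    refine ⟨fun t => (φ (γ t) / d).re, ?_, by simp [h0, hφw], ?_, ?_⟩
    · have hφr : AnalyticAt ℝ φ (γ 0) := by rw [h0]; exact hφ.restrictScalars
      exact (Complex.reCLM.analyticAt _).comp ((hφr.comp ha).div analyticAt_const hd0)
    · have h5 := hder.div_const d
      rw [div_self hd0] at h5
      have := Complex.reCLM.hasFDerivAt.comp_hasDerivAt (0 : ℝ) h5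
      rwa [Complex.reCLM_apply, Complex.one_re] at this
    · filter_upwards [him] with t ht
      have : (((φ (γ t) / d).re : ℝ) : ℂ) = φ (γ t) / d := Complex.ext (by simp) (by simp [ht])
      rw [this, mul_div_cancel₀ _ hd0]
  obtain ⟨x₁, xa₁, x₁0, xd₁, hx₁⟩ := line γ₁ a₁ h₁ z₁ rfl
  obtain ⟨x₂, xa₂, x₂0, xd₂, hx₂⟩ := line γ₂ a₂ h₂ z₂ hd.symm
  have xd₂' : deriv x₂ 0 ≠ 0 := by rw [xd₂.deriv]; exact one_ne_zero
  -- The change of parameter `h = x₂⁻¹ ∘ x₁` carries `γ₂` to `γ₁`. Since both have unit speed and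
  -- `h' 0 = 1`, `h' = 1` near `0` and `h` is the identity.
  set r := xa₂.hasStrictDerivAt.localInverse _ _ _ xd₂' with hr
  have ra : AnalyticAt ℝ r (x₂ 0) := xa₂.analyticAt_localInverse xd₂'
  have r0 : r 0 = 0 := by
    have : r (x₂ 0) = 0 := HasStrictFDerivAt.localInverse_apply_image ..
    rwa [x₂0] at this
  rw [x₂0, ← x₁0] at ra
  set h : ℝ → ℝ := r ∘ x₁ with hh
  have ha : AnalyticAt ℝ h 0 := ra.comp xa₁
  have h0 : h 0 = 0 := by simp [hh, x₁0, r0]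
  have hcont : Tendsto h (𝓝 0) (𝓝 0) := by
    have := ha.continuousAt
    rwa [ContinuousAt, h0] at this
  have hx : ∀ᶠ t in 𝓝 0, x₂ (h t) = x₁ t := by
    have h1 := xa₂.hasStrictDerivAt.eventually_right_inverse xd₂'
    rw [x₂0] at h1
    have hc : Tendsto x₁ (𝓝 0) (𝓝 0) := by
      have := xa₁.continuousAt
      rwa [ContinuousAt, x₁0] at this
    exact hc.eventually h1
  obtain ⟨U, hU, hUi⟩ : ∃ U ∈ 𝓝 w, InjOn φ U := by
    have h3 := hφ.hasStrictDerivAt.hasStrictFDerivAt_equiv hφ'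
    exact ⟨_, (h3.toOpenPartialHomeomorph _).open_source.mem_nhds
        h3.mem_toOpenPartialHomeomorph_source, (h3.toOpenPartialHomeomorph _).injOn⟩
  have c₁ : Tendsto γ₁ (𝓝 0) (𝓝 w) := by
    have := a₁.continuousAt
    rwa [ContinuousAt, h₁] at this
  have c₂ : Tendsto γ₂ (𝓝 0) (𝓝 w) := by
    have := a₂.continuousAt
    rwa [ContinuousAt, h₂] at this
  have hγ : γ₁ =ᶠ[𝓝 0] γ₂ ∘ h := by
    filter_upwards [hx, hx₁, hcont.eventually hx₂, c₁ hU, (c₂.comp hcont) hU]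
      with t e1 e2 e3 e4 e5
    exact hUi e4 e5 (by rw [e2, Function.comp_apply, e3, e1])
  have hder : ∀ᶠ t in 𝓝 0, deriv γ₁ t = deriv h t • deriv γ₂ (h t) := by
    filter_upwards [hγ.eventuallyEq_nhds, ha.eventually_analyticAt,
      hcont.eventually a₂.eventually_analyticAt] with t e1 e2 e3
    rw [e1.deriv_eq]
    exact (e3.differentiableAt.hasDerivAt.scomp t e2.differentiableAt.hasDerivAt).deriv
  have hd1 : deriv h 0 = 1 := by
    have e := hder.self_of_nhds
    rw [h0, ← hd] at e
    have e' : ((deriv h 0 : ℝ) : ℂ) * deriv γ₁ 0 = 1 * deriv γ₁ 0 := by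
      rw [one_mul, ← Complex.real_smul]
      exact e.symm
    exact_mod_cast mul_right_cancel₀ hγ0 e'
  have hpos : ∀ᶠ t in 𝓝 0, 0 < deriv h t :=
    ha.deriv.continuousAt.eventually (lt_mem_nhds (by rw [hd1]; exact one_pos))
  have hone : ∀ᶠ t in 𝓝 0, DifferentiableAt ℝ h t ∧ deriv h t = 1 := by
    filter_upwards [hder, hpos, s₁, hcont.eventually s₂, ha.eventually_analyticAt]
      with t e1 e2 e3 e4 e5
    refine ⟨e5.differentiableAt, ?_⟩
    have := congrArg norm e1
    rw [norm_smul, e3, e4, mul_one, Real.norm_of_nonneg e2.le] at this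
    exact this.symm
  obtain ⟨ε, hε, hball⟩ := Metric.eventually_nhds_iff_ball.mp hone
  have hid : ∀ t ∈ Metric.ball (0 : ℝ) ε, h t = t := by
    intro t ht
    have h5 := (convex_ball (0 : ℝ) ε).is_const_of_fderivWithin_eq_zero (𝕜 := ℝ)
      (f := fun t => h t - t)
      (fun s hs => ((hball s hs).1.sub differentiableAt_id).differentiableWithinAt)
      (fun s hs => by
        have e : HasDerivAt (fun t => h t - t) (1 - 1) s :=
          ((hball s hs).2 ▸ (hball s hs).1.hasDerivAt).sub (hasDerivAt_id s)
        rw [sub_self] at e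
        rw [fderivWithin_of_isOpen Metric.isOpen_ball hs]
        ext
        simp [e.hasFDerivAt.fderiv]) ht (Metric.mem_ball_self hε)
    simp only [h0, sub_zero] at h5
    linarith
  filter_upwards [hγ, Metric.ball_mem_nhds _ hε] with t e1 e2
  rw [e1, Function.comp_apply, hid t e2]

/-! ### Global behaviour of a nodal arc: recurrence, periodicity, escape. -/

/-- By Darboux's theorem the derivative keeps one sign, so `y` departs from `y s` at rate at least
`c`, in opposite directions on the two sides of `s`. The intermediate value theorem then applies. -/
theorem exists_eq_of_le_abs_deriv {y y' : ℝ → ℝ} {s ρ c v : ℝ} (hρ : 0 ≤ ρ) (hc : 0 < c)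
    (hy : ∀ t ∈ Icc (s - ρ) (s + ρ), HasDerivAt y (y' t) t)
    (hy' : ∀ t ∈ Icc (s - ρ) (s + ρ), c ≤ |y' t|) (hv : |v - y s| ≤ c * ρ) :
    ∃ τ ∈ Icc (s - ρ) (s + ρ), y τ = v := by
  have main : ∀ (y y' : ℝ → ℝ) (v : ℝ), (∀ t ∈ Icc (s - ρ) (s + ρ), HasDerivAt y (y' t) t) →
      (∀ t ∈ Icc (s - ρ) (s + ρ), c ≤ y' t) → |v - y s| ≤ c * ρ →
      ∃ τ ∈ Icc (s - ρ) (s + ρ), y τ = v := by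
    intro y y' v hy hy' hv
    have hcont : ContinuousOn y (Icc (s - ρ) (s + ρ)) :=
      fun t ht => (hy t ht).continuousAt.continuousWithinAt
    have hmvt := (convex_Icc (s - ρ) (s + ρ)).mul_sub_le_image_sub_of_le_deriv hcont
      (fun t ht => (hy t (interior_subset ht)).differentiableAt.differentiableWithinAt)
      (C := c) (fun t ht => by
        rw [(hy t (interior_subset ht)).deriv]; exact hy' t (interior_subset ht))
    have m1 := hmvt (s - ρ) ⟨le_rfl, by linarith⟩ s ⟨by linarith, by linarith⟩ (by linarith)
    have m2 := hmvt s ⟨by linarith, by linarith⟩ (s + ρ) ⟨by linarith, le_rfl⟩ (by linarith)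
    rw [abs_le] at hv
    have := intermediate_value_Icc (by linarith : s - ρ ≤ s + ρ) hcont
    obtain ⟨τ, hτ, h⟩ := this (show v ∈ Icc _ _ from ⟨by nlinarith, by nlinarith⟩)
    exact ⟨τ, hτ, h⟩
  rcases hasDerivWithinAt_forall_lt_or_forall_gt_of_forall_ne (convex_Icc (s - ρ) (s + ρ))
    (f := y) (f' := y') (m := 0) (fun t ht => (hy t ht).hasDerivWithinAt)
    (fun t ht h => by have := hy' t ht; rw [h, abs_zero] at this; linarith) with h | h
  · obtain ⟨τ, hτ, e⟩ := main (fun t => -y t) (fun t => -y' t) (-v) (fun t ht => (hy t ht).neg)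
      (fun t ht => by rw [← abs_of_neg (h t ht)]; exact hy' t ht)
      (by rw [← abs_neg]; convert hv using 2; ring)
    exact ⟨τ, hτ, neg_injective e⟩
  · exact main y y' v hy (fun t ht => by rw [← abs_of_pos (h t ht)]; exact hy' t ht) hv

namespace IsNodalArc

variable {u : ℂ → ℝ} {Ω : Set ℂ} {I : Set ℝ} {γ : ℝ → ℂ}

theorem dist_le (h : IsNodalArc u Ω I γ) {s t : ℝ} (hs : s ∈ I) (ht : t ∈ I) :
    ‖γ t - γ s‖ ≤ |t - s| := by
  have := h.ordConnected.convex.norm_image_sub_le_of_norm_deriv_le (f := γ) (C := 1)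
    (fun x hx => (h.analytic x hx).differentiableAt) (fun x hx => (h.unit_speed x hx).le) hs ht
  simpa using this

theorem reverse (h : IsNodalArc u Ω I γ) : IsNodalArc u Ω (-I) (fun t => γ (-t)) where
  isOpen := h.isOpen.neg
  ordConnected := by
    refine ⟨fun x hx y hy z hz => ?_⟩
    exact h.ordConnected.out (mem_neg.mp hy) (mem_neg.mp hx) ⟨neg_le_neg hz.2, neg_le_neg hz.1⟩
  nonempty := h.nonempty.neg
  analytic := fun t ht => by
    have h1 : AnalyticAt ℝ (fun t : ℝ => -t) t := analyticAt_id.neg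
    exact AnalyticAt.fun_comp (h.analytic (-t) ht) h1
  unit_speed := fun t ht => by
    rw [deriv_comp_neg, norm_neg]
    exact h.unit_speed _ ht
  mapsTo := fun t ht => h.mapsTo ht

theorem eventually_mem (h : IsNodalArc u Ω I γ) {t : ℝ} (ht : t ∈ I) : ∀ᶠ s in 𝓝 t, s ∈ I :=
  h.isOpen.mem_nhds ht

/-- Near a point of `I`, two nodal arcs through the same point with the same velocity coincide. -/
theorem eventuallyEq {f : ℂ → ℂ} (hf : AnalyticOnNhd ℂ f Ω) (hu : ∀ z ∈ Ω, (f z).re = u z)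
    {J : Set ℝ} {δ : ℝ → ℂ} (h : IsNodalArc u Ω I γ) (h' : IsNodalArc u Ω J δ) {s t : ℝ}
    (hs : s ∈ I) (ht : t ∈ J) (hst : γ s = δ t) (hd : deriv γ s = deriv δ t)
    (hnc : ¬ ∀ᶠ z in 𝓝 (γ s), f z = f (γ s)) :
    (fun τ => γ (s + τ)) =ᶠ[𝓝 0] fun τ => δ (t + τ) := by
  have shift : ∀ s : ℝ, Tendsto (fun τ : ℝ => s + τ) (𝓝 0) (𝓝 s) := fun s => by
    have : ContinuousAt (fun τ : ℝ => s + τ) 0 := by fun_prop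
    simpa [ContinuousAt] using this
  have key : ∀ (J : Set ℝ) (δ : ℝ → ℂ), IsNodalArc u Ω J δ → ∀ t ∈ J,
      AnalyticAt ℝ (fun τ => δ (t + τ)) 0 ∧ (∀ᶠ τ in 𝓝 0, ‖deriv (fun τ => δ (t + τ)) τ‖ = 1) ∧
      ∀ᶠ τ in 𝓝 0, (f (δ (t + τ))).re = 0 := by
    intro J δ h' t ht
    have hmem : ∀ᶠ τ in 𝓝 0, t + τ ∈ J := (shift t).eventually (h'.eventually_mem ht)
    refine ⟨?_, ?_, ?_⟩
    · have h1 : AnalyticAt ℝ (fun τ : ℝ => t + τ) 0 := analyticAt_const.add analyticAt_id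
      exact AnalyticAt.fun_comp (g := δ) (by rw [add_zero]; exact h'.analytic t ht) h1
    · filter_upwards [hmem] with τ hτ
      rw [deriv_comp_const_add]
      exact h'.unit_speed _ hτ
    · filter_upwards [hmem] with τ hτ
      rw [hu _ (h'.mapsTo hτ).1]
      exact (h'.mapsTo hτ).2
  obtain ⟨a₁, s₁, z₁⟩ := key I γ h s hs
  obtain ⟨a₂, s₂, z₂⟩ := key J δ h' t ht
  refine eventuallyEq_of_re_eq_zero_of_deriv_eq (hf _ (h.mapsTo hs).1)
    (by rw [hu _ (h.mapsTo hs).1]; exact (h.mapsTo hs).2) hnc a₁ a₂ (by simp) (by simp [hst])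
    s₁ s₂ z₁ z₂ ?_
  rw [deriv_comp_const_add, deriv_comp_const_add]
  simpa using hd

/-- The velocity of a nodal arc is tangent to the level set. -/
theorem re_deriv_mul_deriv {f : ℂ → ℂ} (hf : AnalyticOnNhd ℂ f Ω)
    (hu : ∀ z ∈ Ω, (f z).re = u z) (h : IsNodalArc u Ω I γ) {t : ℝ} (ht : t ∈ I) :
    (deriv f (γ t) * deriv γ t).re = 0 := by
  have h1 := hasDerivAt_comp_real (hf _ (h.mapsTo ht).1).differentiableAt
    (h.analytic t ht).differentiableAt
  have h2 : HasDerivAt (fun s => (f (γ s)).re) (deriv f (γ t) * deriv γ t).re t :=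
    Complex.reCLM.hasFDerivAt.comp_hasDerivAt t h1
  have h3 : (fun s => (f (γ s)).re) =ᶠ[𝓝 t] fun _ => 0 := by
    filter_upwards [h.eventually_mem ht] with s hs
    rw [hu _ (h.mapsTo hs).1]
    exact (h.mapsTo hs).2
  exact (h2.congr_of_eventuallyEq h3.symm).unique (hasDerivAt_const t 0)

/-- A nodal arc that comes back arbitrarily close to a regular point, arbitrarily late, passes
through this point arbitrarily late. -/
theorem exists_eq_of_frequently_near {f : ℂ → ℂ} (hΩ : IsOpen Ω) (hf : AnalyticOnNhd ℂ f Ω)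
    (hu : ∀ z ∈ Ω, (f z).re = u z) (h : IsNodalArc u Ω I γ) (hI : Ici 0 ⊆ I) {w : ℂ} (hw : w ∈ Ω)
    (hw0 : u w = 0) (hfw : deriv f w ≠ 0) (hnear : ∀ ε > 0, ∀ T : ℝ, ∃ s ≥ T, ‖γ s - w‖ < ε) (T : ℝ) :
    ∃ τ ≥ T, γ τ = w := by
  have hc : 0 < ‖deriv f w‖ / 2 := by positivity
  set c := ‖deriv f w‖ / 2 with hcdef
  obtain ⟨U, hU, hUi⟩ : ∃ U ∈ 𝓝 w, InjOn f U := by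
    have h3 := (hf w hw).hasStrictDerivAt.hasStrictFDerivAt_equiv hfw
    exact ⟨_, (h3.toOpenPartialHomeomorph _).open_source.mem_nhds
        h3.mem_toOpenPartialHomeomorph_source, (h3.toOpenPartialHomeomorph _).injOn⟩
  have hcev : ∀ᶠ z in 𝓝 w, c < ‖deriv f z‖ :=
    (hf w hw).deriv.continuousAt.norm.eventually (lt_mem_nhds (by
      rw [hcdef]; exact half_lt_self (norm_pos_iff.mpr hfw)))
  obtain ⟨δ, hδ, hball⟩ := Metric.eventually_nhds_iff_ball.mp
    (hcev.and ((eventually_mem_set.mpr hU).and (hΩ.mem_nhds hw)))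
  set ρ := δ / 2 with hρdef
  have hρ : 0 < ρ := by positivity
  have hfc : ∀ᶠ z in 𝓝 w, ‖f z - f w‖ < c * ρ := by
    have := ((hf w hw).continuousAt.sub continuousAt_const).norm (f := fun z => f z - f w)
    refine this.eventually (gt_mem_nhds ?_)
    simp only [sub_self, norm_zero]
    positivity
  obtain ⟨ε, hε, hball'⟩ := Metric.eventually_nhds_iff_ball.mp hfc
  -- Starting after `max T 0 + ρ` keeps the whole window of half-width `ρ` around `s` inside `I` and
  -- beyond `T`.
  obtain ⟨s, hsT, hs⟩ := hnear (min ε ρ) (lt_min hε hρ) (max T 0 + ρ)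
  have hT0 : 0 ≤ max T 0 := le_max_right _ _
  have hmemI : ∀ t ∈ Icc (s - ρ) (s + ρ), t ∈ I := fun t ht => hI (by
    have := ht.1
    simp only [mem_Ici]
    linarith)
  have hsI : s ∈ I := hmemI s ⟨by linarith, by linarith⟩
  have hclose : ∀ t ∈ Icc (s - ρ) (s + ρ), γ t ∈ Metric.ball w δ := by
    intro t ht
    rw [mem_ball_iff_norm]
    have h1 := h.dist_le hsI (hmemI t ht)
    have h2 : |t - s| ≤ ρ := abs_le.mpr ⟨by linarith [ht.1], by linarith [ht.2]⟩
    calc ‖γ t - w‖ ≤ ‖γ t - γ s‖ + ‖γ s - w‖ := norm_sub_le_norm_sub_add_norm_sub ..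
      _ < ρ + ρ := by linarith [lt_of_lt_of_le hs (min_le_right ε ρ)]
      _ = δ := by rw [hρdef]; ring
  have hzero : ∀ t ∈ Icc (s - ρ) (s + ρ), (f (γ t)).re = 0 := fun t ht => by
    rw [hu _ (h.mapsTo (hmemI t ht)).1]
    exact (h.mapsTo (hmemI t ht)).2
  -- Along the arc `Re f` stays `0`, so `Im f` moves with speed `‖deriv f‖ ≥ c` and soon takes the
  -- value `Im (f w)`. Local injectivity of `f` turns equality of values into equality of points.
  obtain ⟨τ, hτ, e⟩ := exists_eq_of_le_abs_deriv (y := fun t => (f (γ t)).im)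
    (y' := fun t => (deriv f (γ t) * deriv γ t).im) (s := s) (v := (f w).im) hρ.le hc
    (fun t ht => Complex.imCLM.hasFDerivAt.comp_hasDerivAt t
      (hasDerivAt_comp_real (hf _ (h.mapsTo (hmemI t ht)).1).differentiableAt
        (h.analytic t (hmemI t ht)).differentiableAt))
    (fun t ht => by
      have h1 := h.re_deriv_mul_deriv hf hu (hmemI t ht)
      rw [Complex.abs_im_eq_norm.mpr h1, norm_mul, h.unit_speed t (hmemI t ht), mul_one]
      exact (hball _ (hclose t ht)).1.le)
    (by
      rw [abs_sub_comm, ← Complex.sub_im]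
      exact (Complex.abs_im_le_norm _).trans (hball' _ (by
        rw [mem_ball_iff_norm]
        exact lt_of_lt_of_le hs (min_le_left ε ρ))).le)
  refine ⟨τ, ?_, ?_⟩
  · have := hτ.1
    have := le_max_left T 0
    linarith
  · refine hUi (hball _ (hclose τ hτ)).2.1 (mem_of_mem_nhds hU) (Complex.ext ?_ e)
    rw [hzero τ hτ, hu w hw, hw0]

end IsNodalArc

theorem not_eventually_eq_of_not_const {f : ℂ → ℂ} {R : ℝ}
    (hf : AnalyticOnNhd ℂ f (Metric.ball 0 R))
    (hnc : ¬ ∃ a, ∀ z ∈ Metric.ball (0 : ℂ) R, f z = a) {w : ℂ} (hw : w ∈ Metric.ball (0 : ℂ) R) :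
    ¬ ∀ᶠ z in 𝓝 w, f z = f w := fun h =>
  hnc ⟨f w, fun _ hz => hf.eqOn_of_preconnected_of_eventuallyEq
    (g := fun _ => f w) analyticOnNhd_const (convex_ball 0 R).isPreconnected hw h hz⟩

/-- All but finitely many circles inside the disc contain no critical point. -/
theorem exists_radius_forall_deriv_ne_zero {f : ℂ → ℂ} {R : ℝ}
    (hf : AnalyticOnNhd ℂ f (Metric.ball 0 R))
    (hnc : ¬ ∃ a, ∀ z ∈ Metric.ball (0 : ℂ) R, f z = a) {r : ℝ} (hr : r < R) :
    ∃ r' ∈ Ioo r R, ∀ w : ℂ, ‖w‖ = r' → deriv f w ≠ 0 := by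
  obtain ⟨r₂, hr₂, hr₂R⟩ := exists_between hr
  set S : Set ℂ := {w | w ∈ Metric.closedBall (0 : ℂ) r₂ ∧ deriv f w = 0} with hS
  have hsub : Metric.closedBall (0 : ℂ) r₂ ⊆ Metric.ball 0 R := Metric.closedBall_subset_ball hr₂R
  have hfin : S.Finite := by
    by_contra hinf
    obtain ⟨x, hx, hacc⟩ := Set.Infinite.exists_accPt_of_subset_isCompact hinf
      (isCompact_closedBall (0 : ℂ) r₂) (fun w hw => hw.1)
    rw [accPt_iff_frequently_nhdsNE] at hacc
    have h0 := hf.deriv.eqOn_zero_of_preconnected_of_frequently_eq_zero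
      (convex_ball 0 R).isPreconnected (hsub hx) (hacc.mono fun w hw => hw.2)
    refine hnc ⟨f x, fun z hz => ?_⟩
    exact Metric.isOpen_ball.is_const_of_deriv_eq_zero (convex_ball 0 R).isPreconnected
      hf.differentiableOn h0 hz (hsub hx)
  obtain ⟨r', hr', hn⟩ := (Ioo_infinite hr₂).exists_notMem_finite (hfin.image norm)
  refine ⟨r', ⟨hr'.1, hr'.2.trans hr₂R⟩, fun w hw h0 => hn ⟨w, ⟨?_, h0⟩, hw⟩⟩
  rw [mem_closedBall_zero_iff, hw]
  exact hr'.2.le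

/-- A nodal arc with two distinct times of equal position and velocity is periodic, so its forward
half has the image of a compact piece. -/
theorem IsNodalArc.exists_mem_Icc_eq {f : ℂ → ℂ} {u : ℂ → ℝ} {Ω : Set ℂ} {I : Set ℝ} {γ : ℝ → ℂ}
    (hf : AnalyticOnNhd ℂ f Ω) (hu : ∀ z ∈ Ω, (f z).re = u z) (h : IsNodalArc u Ω I γ)
    (hI : Ici 0 ⊆ I) {a b : ℝ} (ha : 0 ≤ a) (hab : a < b) (hγ : γ a = γ b)
    (hd : deriv γ a = deriv γ b) (hnc : ¬ ∀ᶠ z in 𝓝 (γ a), f z = f (γ a)) (t : ℝ) (ht : 0 ≤ t) :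
    ∃ s ∈ Icc 0 (b - a), γ t = γ s := by
  have hT : 0 < b - a := sub_pos.mpr hab
  have hloc := h.eventuallyEq hf hu h (hI ha) (hI (ha.trans hab.le)) hγ hd hnc
  -- Local coincidence with the translate by `b - a` spreads to all nonnegative times by analytic
  -- continuation.
  have hloc' : γ =ᶠ[𝓝 a] fun t => γ (t + (b - a)) := by
    have h1 : Tendsto (fun τ : ℝ => τ - a) (𝓝 a) (𝓝 0) := by
      have : ContinuousAt (fun τ : ℝ => τ - a) a := by fun_prop
      simpa [ContinuousAt] using this
    filter_upwards [h1.eventually hloc] with τ hτ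
    have e1 : a + (τ - a) = τ := by ring
    have e2 : b + (τ - a) = τ + (b - a) := by ring
    rwa [e1, e2] at hτ
  have hper : EqOn γ (fun t => γ (t + (b - a))) (Ici 0) := by
    refine AnalyticOnNhd.eqOn_of_preconnected_of_eventuallyEq (𝕜 := ℝ)
      (fun t ht => h.analytic t (hI ht)) (fun t ht => ?_) isPreconnected_Ici ha hloc'
    refine AnalyticAt.fun_comp (g := γ) (h.analytic _ (hI ?_)) (analyticAt_id.add analyticAt_const)
    simp only [mem_Ici] at *
    linarith
  have hperk : ∀ k : ℕ, ∀ t, 0 ≤ t → γ (t + k * (b - a)) = γ t := by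
    intro k
    induction k with
    | zero => simp
    | succ k ih =>
      intro t ht
      have e := hper (x := t + k * (b - a)) (by simp only [mem_Ici]; positivity)
      simp only at e
      rw [← ih t ht, e]
      push_cast
      ring_nf
  refine ⟨t - ⌊t / (b - a)⌋₊ * (b - a), ⟨?_, ?_⟩, ?_⟩
  · have := Nat.floor_le (div_nonneg ht hT.le)
    rw [le_div_iff₀ hT] at this
    linarith
  · have := (Nat.lt_floor_add_one (t / (b - a))).le
    rw [div_le_iff₀ hT] at this
    linarith
  · have e := hperk ⌊t / (b - a)⌋₊ (t - ⌊t / (b - a)⌋₊ * (b - a)) (by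
      have := Nat.floor_le (div_nonneg ht hT.le)
      rw [le_div_iff₀ hT] at this
      linarith)
    rwa [sub_add_cancel] at e

/-- The forward half of a nodal arc in a disc either stays in a smaller disc or leaves every
smaller disc. -/
theorem IsNodalArc.bounded_or_exits {f : ℂ → ℂ} {u : ℂ → ℝ} {R : ℝ} {I : Set ℝ} {γ : ℝ → ℂ}
    (hf : AnalyticOnNhd ℂ f (Metric.ball 0 R)) (hu : ∀ z ∈ Metric.ball 0 R, (f z).re = u z)
    (hnc : ¬ ∃ a, ∀ z ∈ Metric.ball (0 : ℂ) R, f z = a)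
    (h : IsNodalArc u (Metric.ball 0 R) I γ) (h0 : 0 ∈ I) :
    (∃ ρ < R, ∀ t ∈ I, 0 ≤ t → ‖γ t‖ ≤ ρ) ∨
      ∀ r < R, ∃ t₀ ∈ I, 0 ≤ t₀ ∧ ∀ t ∈ I, t₀ ≤ t → r < ‖γ t‖ := by
  rw [or_iff_not_imp_right]
  intro hne
  push Not at hne
  obtain ⟨r, hrR, hr⟩ := hne
  have hball : ∀ t ∈ I, ‖γ t‖ < R := fun t ht => by
    have := (h.mapsTo ht).1
    rwa [mem_ball_zero_iff] at this
  have hcompact : ∀ T ∈ I, 0 ≤ T → ∃ ρ < R, ∀ t ∈ Icc 0 T, ‖γ t‖ ≤ ρ := by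
    intro T hT hT0
    have hsub : Icc 0 T ⊆ I := h.ordConnected.out h0 hT
    obtain ⟨x, hx, hmax⟩ := isCompact_Icc.exists_isMaxOn (nonempty_Icc.mpr hT0)
      (f := fun t => ‖γ t‖) (fun t ht =>
        (h.analytic t (hsub ht)).continuousAt.norm.continuousWithinAt)
    exact ⟨‖γ x‖, hball x (hsub hx), fun t ht => hmax ht⟩
  by_cases hbdd : BddAbove I
  · set b := sSup I with hb
    have hIb : ∀ t ∈ I, t ≤ b := fun t ht => le_csSup hbdd ht
    have hb0 : 0 ≤ b := hIb 0 h0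
    -- With less than `(R - r) / 2` of parameter left, an arc of unit speed that is within radius
    -- `r` cannot get beyond radius `(R + r) / 2`.
    obtain ⟨t₁, ht₁, hlt⟩ := exists_lt_of_lt_csSup h.nonempty
      (show b - (R - r) / 2 < sSup I by rw [← hb]; linarith)
    have hm : max t₁ 0 ∈ I := by
      rcases max_choice t₁ 0 with e | e <;> rw [e] <;> assumption
    obtain ⟨t, ht, htge, htr⟩ := hr _ hm (le_max_right _ _)
    have ht0 : 0 ≤ t := (le_max_right _ _).trans htge
    obtain ⟨ρ, hρ, hρt⟩ := hcompact t ht ht0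
    refine ⟨max ρ ((R + r) / 2), max_lt hρ (by linarith), fun s hs hs0 => ?_⟩
    rcases le_total s t with hst | hst
    · exact (hρt s ⟨hs0, hst⟩).trans (le_max_left _ _)
    · refine le_trans ?_ (le_max_right _ _)
      have h1 := h.dist_le ht hs
      rw [abs_of_nonneg (sub_nonneg.mpr hst)] at h1
      have h2 := norm_sub_norm_le (γ s) (γ t)
      have h3 := hIb s hs
      have h4 := (le_max_left t₁ 0).trans htge
      linarith
  · have hI : Ici 0 ⊆ I := by
      intro t ht
      rw [not_bddAbove_iff] at hbdd
      obtain ⟨s, hs, hts⟩ := hbdd t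
      exact h.ordConnected.out h0 hs ⟨ht, hts.le⟩
    by_contra hnb
    push Not at hnb
    -- The arc oscillates between radius at most `r` and radii near `R`, so it meets this circle
    -- without critical points arbitrarily late. An accumulation point `w` of these crossings is
    -- regular, hence is itself visited arbitrarily late.
    obtain ⟨r', ⟨hrr', hr'R⟩, hreg⟩ := exists_radius_forall_deriv_ne_zero hf hnc hrR
    have hhit : ∀ T : ℝ, ∃ t ≥ T, 0 ≤ t ∧ ‖γ t‖ = r' := by
      intro T
      obtain ⟨ρ, hρ, hρT⟩ := hcompact (max T 0) (hI (mem_Ici.mpr (le_max_right _ _))) (le_max_right _ _)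
      obtain ⟨t₁, ht₁, ht₁0, hlt⟩ := hnb (max ρ r') (max_lt hρ hr'R)
      have hTt : max T 0 < t₁ := by
        by_contra hle
        have := hρT t₁ ⟨ht₁0, not_lt.mp hle⟩
        linarith [le_max_left ρ r']
      obtain ⟨t₂, ht₂, ht₁₂, hle⟩ := hr t₁ ht₁ ht₁0
      have hcont : ContinuousOn (fun t => ‖γ t‖) (Icc t₁ t₂) := fun t ht =>
        (h.analytic t (hI (ht₁0.trans ht.1))).continuousAt.norm.continuousWithinAt
      obtain ⟨t, ht, e⟩ := intermediate_value_Icc' ht₁₂ hcont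
        (show r' ∈ Icc _ _ from ⟨hle.trans hrr'.le, (le_max_right ρ r').trans hlt.le⟩)
      exact ⟨t, ((le_max_left T 0).trans hTt.le).trans ht.1, ht₁0.trans ht.1, e⟩
    choose s hsT hs0 hs using fun k : ℕ => hhit k
    obtain ⟨w, hw, φ, hφ, hlim⟩ := (isCompact_sphere (0 : ℂ) r').tendsto_subseq
      (x := fun k => γ (s k)) (fun k => by simp [hs k])
    have hwn : ‖w‖ = r' := by simpa using hw
    have hwball : w ∈ Metric.ball (0 : ℂ) R := by rw [mem_ball_zero_iff, hwn]; exact hr'R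
    have hw0 : u w = 0 := by
      have h1 : Tendsto (fun k => (f (γ (s (φ k)))).re) atTop (𝓝 (f w).re) :=
        (Complex.continuous_re.tendsto _).comp ((hf w hwball).continuousAt.tendsto.comp hlim)
      rw [← hu w hwball]
      refine tendsto_nhds_unique h1 (tendsto_const_nhds.congr fun k => ?_)
      rw [hu _ (h.mapsTo (hI (hs0 _))).1]
      exact (h.mapsTo (hI (hs0 _))).2.symm
    have hpass := h.exists_eq_of_frequently_near Metric.isOpen_ball hf hu hI hwball hw0
      (hreg w hwn) (fun ε hε T => by
        have h1 : ∀ᶠ k in atTop, ‖γ (s (φ k)) - w‖ < ε := by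
          have := Metric.tendsto_atTop.mp hlim ε hε
          obtain ⟨N, hN⟩ := this
          exact eventually_atTop.mpr ⟨N, fun k hk => by rw [← dist_eq_norm]; exact hN k hk⟩
        obtain ⟨k, hk, hkT⟩ := (h1.and (eventually_ge_atTop ⌈T⌉₊)).exists
        refine ⟨s (φ k), ?_, hk⟩
        calc T ≤ (⌈T⌉₊ : ℝ) := Nat.le_ceil T
          _ ≤ k := by exact_mod_cast hkT
          _ ≤ φ k := by exact_mod_cast hφ.id_le k
          _ ≤ s (φ k) := hsT _)
    -- There are only two unit tangents at `w`, so two of three passages share their velocity. The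
    -- arc is then periodic, which confines its forward half to a smaller disc, contrary to `hnb`.
    obtain ⟨τ₁, hτ₁, e₁⟩ := hpass 0
    obtain ⟨τ₂, hτ₂, e₂⟩ := hpass (τ₁ + 1)
    obtain ⟨τ₃, hτ₃, e₃⟩ := hpass (τ₂ + 1)
    have hτ₁' : 0 ≤ τ₁ := hτ₁
    have hτ₂' : 0 ≤ τ₂ := by linarith
    have hτ₃' : 0 ≤ τ₃ := by linarith
    have two : ∀ x y : ℂ, ‖x‖ = 1 → ‖y‖ = 1 → (deriv f w * x).re = 0 → (deriv f w * y).re = 0 →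
        x = y ∨ x = -y := by
      intro x y hx hy hx0 hy0
      have hdw := norm_pos_iff.mpr (hreg w hwn)
      have hx1 : |(deriv f w * x).im| = ‖deriv f w‖ := by
        rw [Complex.abs_im_eq_norm.mpr hx0, norm_mul, hx, mul_one]
      have hy1 : |(deriv f w * y).im| = ‖deriv f w‖ := by
        rw [Complex.abs_im_eq_norm.mpr hy0, norm_mul, hy, mul_one]
      rcases abs_eq_abs.mp (hx1.trans hy1.symm) with e | e
      · left
        exact mul_left_cancel₀ (hreg w hwn) (Complex.ext (hx0.trans hy0.symm) e)
      · right
        refine mul_left_cancel₀ (hreg w hwn) (Complex.ext ?_ ?_)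
        · rw [mul_neg, Complex.neg_re, hx0, hy0, neg_zero]
        · rw [mul_neg, Complex.neg_im, e]
    have hper : ∀ a b, 0 ≤ a → a < b → γ a = w → γ b = w → deriv γ a = deriv γ b → False := by
      intro a b ha hab hγa hγb hd
      obtain ⟨ρ, hρ, hρT⟩ := hcompact (b - a) (hI (sub_nonneg.mpr hab.le)) (sub_nonneg.mpr hab.le)
      obtain ⟨t, ht, ht0, hlt⟩ := hnb ρ hρ
      obtain ⟨s, hs, e⟩ := h.exists_mem_Icc_eq hf hu hI ha hab (hγa.trans hγb.symm) hd
        (by rw [hγa]; exact not_eventually_eq_of_not_const hf hnc hwball) t ht0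
      rw [e] at hlt
      exact absurd (hρT s hs) (not_le.mpr hlt)
    have tang : ∀ τ, 0 ≤ τ → γ τ = w → (deriv f w * deriv γ τ).re = 0 := fun τ hτ e => by
      have := h.re_deriv_mul_deriv hf hu (hI hτ)
      rwa [e] at this
    have d12 := two _ _ (h.unit_speed _ (hI hτ₁')) (h.unit_speed _ (hI hτ₂')) (tang _ hτ₁' e₁)
      (tang _ hτ₂' e₂)
    have d23 := two _ _ (h.unit_speed _ (hI hτ₂')) (h.unit_speed _ (hI hτ₃')) (tang _ hτ₂' e₂)
      (tang _ hτ₃' e₃)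
    rcases d12 with d12 | d12
    · exact hper τ₁ τ₂ hτ₁' (by linarith) e₁ e₂ d12
    rcases d23 with d23 | d23
    · exact hper τ₂ τ₃ hτ₂' (by linarith) e₂ e₃ d23
    · exact hper τ₁ τ₃ hτ₁' (by linarith) e₁ e₃ (by rw [d12, d23, neg_neg])

/-! ### Distinct nodal curves through the origin and the order of vanishing. -/

namespace IsNodalCurve

variable {u : ℂ → ℝ} {Ω : Set ℂ} {I J : Set ℝ} {γ δ : ℝ → ℂ}

theorem reverse (h : IsNodalCurve u Ω I γ) : IsNodalCurve u Ω (-I) (fun t => γ (-t)) where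
  toIsNodalArc := h.toIsNodalArc.reverse
  maximal := fun K η hη hsub heq => by
    have e := h.maximal (-K) (fun t => η (-t)) hη.reverse
      (fun t ht => hsub (by simpa using ht))
      (fun t ht => by
        have := heq (x := -t) (by simpa using ht)
        simpa using this)
    rw [← e, neg_neg]

/-- Two nodal curves that coincide near `0` have the same domain and the same image. -/
theorem image_eq_of_eventuallyEq (h : IsNodalCurve u Ω I γ) (h' : IsNodalCurve u Ω J δ)
    (hI : 0 ∈ I) (hJ : 0 ∈ J) (he : γ =ᶠ[𝓝 0] δ) : γ '' I = δ '' J := by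
  classical
  have hconn : IsPreconnected (I ∩ J) := (h.ordConnected.inter h'.ordConnected).isPreconnected
  have hEq : EqOn γ δ (I ∩ J) := AnalyticOnNhd.eqOn_of_preconnected_of_eventuallyEq (𝕜 := ℝ)
    (fun t ht => h.analytic t ht.1) (fun t ht => h'.analytic t ht.2) hconn ⟨hI, hJ⟩ he
  -- The two curves glue to an arc on `I ∪ J`; maximality of each forces `I = I ∪ J = J`.
  set η : ℝ → ℂ := fun t => if t ∈ I then γ t else δ t with hη
  have hηI : EqOn η γ I := fun t ht => by simp [hη, ht]
  have hηJ : EqOn η δ J := fun t ht => by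
    by_cases htI : t ∈ I
    · simp [hη, htI, hEq ⟨htI, ht⟩]
    · simp [hη, htI]
  have hηI' : ∀ t ∈ I, η =ᶠ[𝓝 t] γ := fun t ht => hηI.eventuallyEq_of_mem (h.isOpen.mem_nhds ht)
  have hηJ' : ∀ t ∈ J, η =ᶠ[𝓝 t] δ := fun t ht => hηJ.eventuallyEq_of_mem (h'.isOpen.mem_nhds ht)
  have harc : IsNodalArc u Ω (I ∪ J) η :=
    { isOpen := h.isOpen.union h'.isOpen
      ordConnected := (IsPreconnected.union 0 hI hJ h.ordConnected.isPreconnected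
        h'.ordConnected.isPreconnected).ordConnected
      nonempty := ⟨0, Or.inl hI⟩
      analytic := fun t ht => ht.elim (fun ht => (h.analytic t ht).congr (hηI' t ht).symm)
        fun ht => (h'.analytic t ht).congr (hηJ' t ht).symm
      unit_speed := fun t ht => ht.elim
        (fun ht => by rw [(hηI' t ht).deriv_eq]; exact h.unit_speed t ht)
        fun ht => by rw [(hηJ' t ht).deriv_eq]; exact h'.unit_speed t ht
      mapsTo := fun t ht => ht.elim (fun ht => by rw [hηI ht]; exact h.mapsTo ht)
        fun ht => by rw [hηJ ht]; exact h'.mapsTo ht }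
  have e1 := h.maximal _ _ harc subset_union_left hηI.symm
  have e2 := h'.maximal _ _ harc subset_union_right hηJ.symm
  have hIJ : I = J := e1.symm.trans e2
  subst hIJ
  exact image_congr fun t ht => hEq ⟨ht, ht⟩

end IsNodalCurve

/-- If `n` distinct nodal curves of `Re f` pass through `0`, then `f - f 0` vanishes at `0` to order
at least `n`. -/
theorem le_analyticOrderAt_of_hasOnlyNodalCurvesThrough {f : ℂ → ℂ} {u : ℂ → ℝ} {Ω : Set ℂ} {n : ℕ}
    (hf : AnalyticOnNhd ℂ f Ω) (hu : ∀ z ∈ Ω, (f z).re = u z) (hΩ : 0 ∈ Ω)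
    (hf0 : f 0 = 0) (hnc : ¬ ∀ᶠ z in 𝓝 0, f z = f 0) (h : HasOnlyNodalCurvesThrough u Ω 0 n) :
    (n : ℕ∞) ≤ analyticOrderAt f 0 := by
  obtain ⟨I, γ, hγ, hinj, -⟩ := h
  obtain ⟨m, φ, hm, hφ, hφ0, hφ', hpow⟩ := (hf 0 hΩ).exists_pow_coordinate hnc
  have hord : (m : ℕ∞) ≤ analyticOrderAt f 0 := by
    have e : f =ᶠ[𝓝 0] φ ^ m := by
      filter_upwards [hpow] with z hz
      rw [hf0, sub_zero] at hz
      simpa using hz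
    rw [analyticOrderAt_congr e, analyticOrderAt_pow hφ]
    have h1 : 1 ≤ analyticOrderAt φ 0 := by
      rw [Order.one_le_iff_ne_zero]
      exact (hφ.analyticOrderAt_ne_zero).mpr hφ0
    calc (m : ℕ∞) = m • 1 := by simp
      _ ≤ m • analyticOrderAt φ 0 := by gcongr
  refine le_trans ?_ hord
  have hdir : ∀ k, ((deriv φ 0 * deriv (γ k) 0) ^ m).re = 0 := by
    intro k
    obtain ⟨hk, h0, hk0⟩ := hγ k
    have hne : deriv (γ k) 0 ≠ 0 := fun e => by
      have := hk.unit_speed 0 h0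
      simp [e] at this
    have hder := hasDerivAt_comp_real (f := φ) (γ := γ k) (t := 0)
      (by rw [hk0]; exact hφ.differentiableAt) (hk.analytic 0 h0).differentiableAt
    rw [hk0] at hder
    refine (eventually_im_div_eq_zero_of_re_pow_eq_zero hm (by simp only [hk0, hφ0]) hder
      (mul_ne_zero hφ' hne) ?_).1
    have hc : Tendsto (γ k) (𝓝 0) (𝓝 0) := by
      have := (hk.analytic 0 h0).continuousAt
      rwa [ContinuousAt, hk0] at this
    filter_upwards [hc.eventually hpow, hk.isOpen.mem_nhds h0] with t h1 h2
    rw [← h1, hf0, sub_zero, hu _ (hk.mapsTo h2).1]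
    exact (hk.mapsTo h2).2
  -- The `m`-th power of each direction is imaginary of modulus `‖deriv φ 0‖ ^ m`, so its square is
  -- this `A`. Squared directions are used because they do not distinguish a curve from its
  -- reversal; they are `m`-th roots of `A`, at most `m` in number.
  set A : ℂ := -(((‖deriv φ 0‖ ^ m) ^ 2 : ℝ) : ℂ) with hA
  have hroot : ∀ k, ((deriv φ 0 * deriv (γ k) 0) ^ 2) ∈ Polynomial.nthRoots m A := by
    intro k
    obtain ⟨hk, h0, hk0⟩ := hγ k
    rw [Polynomial.mem_nthRoots (by omega), ← pow_mul, mul_comm 2 m, pow_mul]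
    set x := (deriv φ 0 * deriv (γ k) 0) ^ m with hx
    have hxn : ‖x‖ = ‖deriv φ 0‖ ^ m := by
      rw [hx, norm_pow, norm_mul, hk.unit_speed 0 h0, mul_one]
    have hxi : x = (x.im : ℂ) * Complex.I := by
      conv_lhs => rw [← Complex.re_add_im x, hdir k]
      simp
    have hxi2 : |x.im| = ‖x‖ := Complex.abs_im_eq_norm.mpr (hdir k)
    rw [hxi, mul_pow, Complex.I_sq, hA, ← hxn, ← hxi2, sq_abs]
    push_cast
    ring
  have hinj' : Function.Injective fun k => (deriv φ 0 * deriv (γ k) 0) ^ 2 := by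
    intro j k hjk
    obtain ⟨hj, hj0, hj00⟩ := hγ j
    obtain ⟨hk, hk0, hk00⟩ := hγ k
    apply hinj
    have hcase : deriv (γ j) 0 = deriv (γ k) 0 ∨ deriv (γ j) 0 = -deriv (γ k) 0 := by
      have h2 : deriv φ 0 ^ 2 * deriv (γ j) 0 ^ 2 = deriv φ 0 ^ 2 * deriv (γ k) 0 ^ 2 := by
        simpa [mul_pow] using hjk
      exact sq_eq_sq_iff_eq_or_eq_neg.mp (mul_left_cancel₀ (pow_ne_zero 2 hφ') h2)
    have hncj : ¬ ∀ᶠ z in 𝓝 (γ j 0), f z = f (γ j 0) := by rw [hj00]; exact hnc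
    rcases hcase with e | e
    · have := hj.toIsNodalArc.eventuallyEq hf hu hk.toIsNodalArc hj0 hk0 (hj00.trans hk00.symm) e
        hncj
      simp only [zero_add] at this
      exact hj.image_eq_of_eventuallyEq hk hj0 hk0 this
    · have hk' := hk.reverse
      have hk0' : (0 : ℝ) ∈ -I k := by simpa using hk0
      have := hj.toIsNodalArc.eventuallyEq hf hu hk'.toIsNodalArc hj0 hk0'
        (by simp [hj00, hk00]) (by rw [deriv_comp_neg, neg_zero, e]) hncj
      simp only [zero_add] at this
      have e2 := hj.image_eq_of_eventuallyEq hk' hj0 hk0' this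
      simp only at e2 ⊢
      rw [e2]
      ext z
      constructor
      · rintro ⟨t, ht, rfl⟩
        exact ⟨-t, ht, rfl⟩
      · rintro ⟨t, ht, rfl⟩
        exact ⟨-t, by simpa using ht, by simp⟩
  have hcard : n ≤ (Polynomial.nthRoots m A).toFinset.card := by
    have := Finset.card_le_card_of_injOn (s := (Finset.univ : Finset (Fin n)))
      (t := (Polynomial.nthRoots m A).toFinset) _
      (fun k _ => Multiset.mem_toFinset.mpr (hroot k)) hinj'.injOn
    simpa using this
  exact_mod_cast (hcard.trans (Multiset.toFinset_card_le _)).trans (Polynomial.card_nthRoots m A)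

/-! ### Half-branches, sectors and sign changes near the boundary. -/

/-- The function `σ` is, up to the sign `ε`, alternately positive and negative at some increasing
sequence of `N` points of `E`. -/
def Alternates (σ : ℝ → ℝ) (E : Set ℝ) (N : ℕ) (ε : ℝ) : Prop :=
  ∃ θ : ℕ → ℝ, (∀ i < N, θ i ∈ E ∧ 0 < ε * (-1) ^ i * σ (θ i)) ∧ ∀ i, i + 1 < N → θ i < θ (i + 1)

theorem lt_of_forall_lt_succ {θ : ℕ → ℝ} {N : ℕ} (h : ∀ i, i + 1 < N → θ i < θ (i + 1)) {i j : ℕ}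
    (hij : i < j) (hj : j < N) : θ i < θ j := by
  induction j, hij using Nat.le_induction with
  | base => exact h i hj
  | succ j hij ih => exact (ih (by omega)).trans (h j hj)

theorem circleMap_zero_re_mul_exp (r s c : ℝ) :
    (circleMap 0 r s * Complex.exp (-(c * Complex.I))).re = r * Real.cos (s - c) := by
  have e : circleMap 0 r s * Complex.exp (-(c * Complex.I))
      = (r : ℂ) * Complex.exp (((s - c : ℝ) : ℂ) * Complex.I) := by
    rw [circleMap_zero, mul_assoc, ← Complex.exp_add]
    congr 2
    push_cast
    ring
  rw [e, Complex.re_ofReal_mul, Complex.exp_ofReal_mul_I_re]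

/-- Positive exactly in the open sector of the directions between `a` and `b`. -/
noncomputable def sectorFun (a b : ℝ) (z : ℂ) : ℝ :=
  (z * Complex.exp (-(((a + b) / 2 : ℝ) * Complex.I))).re - ‖z‖ * Real.cos ((b - a) / 2)

theorem continuous_sectorFun (a b : ℝ) : Continuous (sectorFun a b) := by
  unfold sectorFun
  fun_prop

theorem sectorFun_circleMap {a b r s : ℝ} (hr : 0 ≤ r) :
    sectorFun a b (circleMap 0 r s)
      = r * (Real.cos (s - (a + b) / 2) - Real.cos ((b - a) / 2)) := by
  rw [sectorFun, circleMap_zero_re_mul_exp, norm_circleMap_zero, abs_of_nonneg hr]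
  ring

theorem sectorFun_pos {a b r s : ℝ} (ha : 0 < a) (hb : b < 2 * Real.pi) (hr : 0 < r)
    (has : a < s) (hsb : s < b) : 0 < sectorFun a b (circleMap 0 r s) := by
  rw [sectorFun_circleMap hr.le]
  refine mul_pos hr (sub_pos.mpr ?_)
  rw [← Real.cos_abs (s - _)]
  exact Real.cos_lt_cos_of_nonneg_of_le_pi (abs_nonneg _) (by linarith)
    (abs_lt.mpr ⟨by linarith, by linarith⟩)

/-- Outside the sector, but within `(0, 2π)`, the angle to the bisector lies strictly between `(b -
a) / 2` and `2π - (b - a) / 2`, where the cosine is smaller. -/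
theorem sectorFun_neg {a b r s : ℝ} (ha : 0 < a) (hab : a < b) (hb : b < 2 * Real.pi) (hr : 0 < r)
    (hs : 0 < s) (hs2 : s < 2 * Real.pi) (h : s < a ∨ b < s) :
    sectorFun a b (circleMap 0 r s) < 0 := by
  rw [sectorFun_circleMap hr.le]
  refine mul_neg_of_pos_of_neg hr (sub_neg.mpr ?_)
  rw [← Real.cos_abs (s - _)]
  have h1 : (b - a) / 2 < |s - (a + b) / 2| := by
    rw [lt_abs]
    rcases h with h | h
    · right; linarith
    · left; linarith
  have h2 : |s - (a + b) / 2| < 2 * Real.pi - (b - a) / 2 :=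
    abs_lt.mpr ⟨by linarith, by linarith⟩
  rcases le_total |s - (a + b) / 2| Real.pi with h3 | h3
  · exact Real.cos_lt_cos_of_nonneg_of_le_pi (by linarith) h3 h1
  · rw [← Real.cos_two_pi_sub]
    exact Real.cos_lt_cos_of_nonneg_of_le_pi (by linarith) (by linarith) (by linarith)

/-- Equality of cosines leaves only the two bounding directions modulo `2π`. A branch avoiding `0`
can thus leave a sector only across one of these rays. -/
theorem eq_circleMap_of_sectorFun_eq_zero {a b : ℝ} {z : ℂ} (hz : z ≠ 0) (h : sectorFun a b z = 0) :
    z = circleMap 0 ‖z‖ a ∨ z = circleMap 0 ‖z‖ b := by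
  set s := Complex.arg z with hs
  have hzs : z = circleMap 0 ‖z‖ s := by
    rw [circleMap_zero]
    exact (Complex.norm_mul_exp_arg_mul_I z).symm
  have hr : 0 < ‖z‖ := norm_pos_iff.mpr hz
  rw [hzs, sectorFun_circleMap hr.le] at h
  have hcos : Real.cos (s - (a + b) / 2) = Real.cos ((b - a) / 2) :=
    sub_eq_zero.mp ((mul_eq_zero.mp h).resolve_left hr.ne')
  have hper : ∀ k : ℤ, z = circleMap 0 ‖z‖ (s + k * (2 * Real.pi)) := by
    intro k
    nth_rewrite 1 [hzs]
    simp only [circleMap_zero]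
    congr 1
    rw [Complex.exp_eq_exp_iff_exists_int]
    refine ⟨-k, ?_⟩
    push_cast
    ring
  rw [Real.cos_eq_cos_iff] at hcos
  obtain ⟨k, hk | hk⟩ := hcos
  · right
    have e : b = s + k * (2 * Real.pi) := by linarith
    rw [e]
    exact hper k
  · left
    have e : a = s + (-k : ℤ) * (2 * Real.pi) := by push_cast; linarith
    rw [e]
    exact hper (-k)

/-- The nodal set is covered by the `2 n` half-branches issuing from the common point. -/
theorem HasOnlyNodalCurvesThrough.exists_halfBranches {u : ℂ → ℝ} {Ω : Set ℂ} {p : ℂ} {n : ℕ}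
    (h : HasOnlyNodalCurvesThrough u Ω p n) :
    ∃ (K : Fin n × Bool → Set ℝ) (η : Fin n × Bool → ℝ → ℂ),
      (∀ k, IsNodalArc u Ω (K k) (η k) ∧ (0 : ℝ) ∈ K k) ∧
      ∀ z ∈ nodalSet u Ω, ∃ k, ∃ t ∈ K k, 0 ≤ t ∧ η k t = z := by
  obtain ⟨I, γ, hγ, -, hcov⟩ := h
  refine ⟨fun k => bif k.2 then I k.1 else -I k.1,
    fun k => bif k.2 then γ k.1 else fun t => γ k.1 (-t), ?_, ?_⟩
  · rintro ⟨k, _ | _⟩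
    · exact ⟨(hγ k).1.toIsNodalArc.reverse, by simpa using (hγ k).2.1⟩
    · exact ⟨(hγ k).1.toIsNodalArc, (hγ k).2.1⟩
  · intro z hz
    rw [hcov, mem_iUnion] at hz
    obtain ⟨k, t, ht, rfl⟩ := hz
    rcases le_total 0 t with h0 | h0
    · exact ⟨(k, true), t, ht, h0, rfl⟩
    · exact ⟨(k, false), -t, by simpa using ht, by simpa using h0, by simp⟩

/-- If the nodal set consists of `n` curves through `0`, then the boundary behaviour of `u` has at
most `2 n` changes of sign. -/
theorem not_alternating_radii {f : ℂ → ℂ} {u : ℂ → ℝ} {R : ℝ} {n : ℕ} (hR : 0 < R)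
    (hf : AnalyticOnNhd ℂ f (Metric.ball 0 R)) (hu : ∀ z ∈ Metric.ball 0 R, (f z).re = u z)
    (hnc : ¬ ∃ a, ∀ z ∈ Metric.ball (0 : ℂ) R, f z = a)
    (h : HasOnlyNodalCurvesThrough u (Metric.ball 0 R) 0 n) {θ : ℕ → ℝ} {ε : ℝ}
    (hθ : ∀ i < 2 * n + 2, θ i ∈ Ioo 0 (2 * Real.pi) ∧
      ∀ᶠ r in 𝓝[<] R, 0 < ε * (-1) ^ i * u (circleMap 0 r (θ i)))
    (hmono : ∀ i, i + 1 < 2 * n + 2 → θ i < θ (i + 1)) : False := by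
  obtain ⟨K, η, hη, hcov⟩ := h.exists_halfBranches
  have hlt : ∀ {i j : ℕ}, i < j → j < 2 * n + 2 → θ i < θ j := lt_of_forall_lt_succ hmono
  obtain ⟨r₀, hr₀0, hr₀R, hr₀⟩ : ∃ r₀, 0 ≤ r₀ ∧ r₀ < R ∧ ∀ r ∈ Ioo r₀ R, ∀ i < 2 * n + 2,
      0 < ε * (-1) ^ i * u (circleMap 0 r (θ i)) := by
    have hev : ∀ᶠ r in 𝓝[<] R, ∀ i ∈ Finset.range (2 * n + 2),
        0 < ε * (-1) ^ i * u (circleMap 0 r (θ i)) :=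
      (Finset.eventually_all _).mpr fun i hi => (hθ i (Finset.mem_range.mp hi)).2
    obtain ⟨l, hl, hsub⟩ := (mem_nhdsLT_iff_exists_Ioo_subset' hR).mp hev
    exact ⟨max l 0, le_max_right _ _, max_lt hl hR, fun r hr i hi =>
      hsub ⟨(le_max_left l 0).trans_lt hr.1, hr.2⟩ i (Finset.mem_range.mpr hi)⟩
  have hball : ∀ {r s : ℝ}, 0 ≤ r → r < R → circleMap 0 r s ∈ Metric.ball (0 : ℂ) R := by
    intro r s h0 h1
    rw [mem_ball_zero_iff, norm_circleMap_zero, abs_of_nonneg h0]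
    exact h1
  -- the branch visits the sector between `θ i` and `θ (i + 1)` at radius `r`
  set V : ℕ → Fin n × Bool → ℝ → Prop := fun i k r => ∃ t ∈ K k, 0 ≤ t ∧ ‖η k t‖ = r ∧
    0 < sectorFun (θ i) (θ (i + 1)) (η k t) ∧
    ∀ j < 2 * n + 1, j ≠ i → sectorFun (θ j) (θ (j + 1)) (η k t) < 0 with hV
  -- The signs on consecutive rays are opposite, so each circle of radius near `R` carries a zero in
  -- each of the `2n + 1` sectors, and some half-branch contains it.
  have hvisit : ∀ i < 2 * n + 1, ∀ r ∈ Ioo r₀ R, ∃ k, V i k r := by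
    intro i hi r hr
    have hr0 : 0 < r := hr₀0.trans_lt hr.1
    have hcont : ContinuousOn (fun s => ε * (-1) ^ i * u (circleMap 0 r s))
        (Icc (θ i) (θ (i + 1))) := by
      have e : (fun s => ε * (-1) ^ i * u (circleMap 0 r s))
          = fun s => ε * (-1) ^ i * (f (circleMap 0 r s)).re := by
        ext s
        rw [hu _ (hball hr0.le hr.2)]
      rw [e]
      refine Continuous.continuousOn (continuous_const.mul (Complex.continuous_re.comp ?_))
      rw [continuous_iff_continuousAt]
      intro s
      exact ContinuousAt.comp (f := circleMap 0 r) (hf _ (hball hr0.le hr.2)).continuousAt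
        (continuous_circleMap 0 r).continuousAt
    have p1 := hr₀ r hr i (by omega)
    have p2 := hr₀ r hr (i + 1) (by omega)
    obtain ⟨s, hs, hs0⟩ := intermediate_value_Ioo' (hmono i (by omega)).le hcont
      (show (0 : ℝ) ∈ Ioo _ _ from ⟨by rw [pow_succ] at p2; linarith, p1⟩)
    have hne : ε * (-1) ^ i ≠ 0 := fun e => by rw [e, zero_mul] at p1; exact lt_irrefl _ p1
    obtain ⟨k, t, ht, ht0, e⟩ := hcov (circleMap 0 r s)
      ⟨hball hr0.le hr.2, (mul_eq_zero.mp hs0).resolve_left hne⟩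
    have ha := (hθ i (by omega)).1
    have hb := (hθ (i + 1) (by omega)).1
    refine ⟨k, t, ht, ht0, ?_, ?_, fun j hj hji => ?_⟩
    · rw [e, norm_circleMap_zero, abs_of_pos hr0]
    · rw [e]
      exact sectorFun_pos ha.1 hb.2 hr0 hs.1 hs.2
    · rw [e]
      refine sectorFun_neg (hθ j (by omega)).1.1 (hmono j (by omega)) (hθ (j + 1) (by omega)).1.2
        hr0 (ha.1.trans hs.1) (hs.2.trans hb.2) ?_
      rcases lt_or_gt_of_ne hji with hlt' | hlt'
      · right
        refine lt_of_le_of_lt ?_ hs.1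
        rcases Nat.lt_or_ge (j + 1) i with h1 | h1
        · exact (hlt h1 (by omega)).le
        · rw [show j + 1 = i by omega]
      · left
        refine lt_of_lt_of_le hs.2 ?_
        rcases Nat.lt_or_ge (i + 1) j with h1 | h1
        · exact (hlt h1 (by omega)).le
        · rw [show i + 1 = j by omega]
  -- There are finitely many half-branches, so one of them serves the sector at radii arbitrarily
  -- close to `R`.
  have hfreq : ∀ i < 2 * n + 1, ∃ k, ∃ᶠ r in 𝓝[<] R, V i k r := by
    intro i hi
    by_contra hno
    push Not at hno
    have hall : ∀ᶠ r in 𝓝[<] R, ∀ k, ¬ V i k r := eventually_all.mpr hno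
    have hIoo : ∀ᶠ r in 𝓝[<] R, r ∈ Ioo r₀ R := Ioo_mem_nhdsLT hr₀R
    obtain ⟨r, h1, h2⟩ := (hall.and hIoo).exists
    obtain ⟨k, hk⟩ := hvisit i hi r h2
    exact h1 k hk
  have hdisj : ∀ i < 2 * n + 1, ∀ j < 2 * n + 1, i ≠ j → ∀ k, (∃ᶠ r in 𝓝[<] R, V i k r) →
      (∃ᶠ r in 𝓝[<] R, V j k r) → False := by
    intro i hi j hj hij k hfi hfj
    obtain ⟨harc, h0⟩ := hη k
    -- A branch staying in a smaller disc visits no sector near `R`. A branch that exits eventually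
    -- remains beyond `r₀`, where no ray `θ i` contains a zero, so it cannot change sector.
    rcases harc.bounded_or_exits hf hu hnc h0 with ⟨ρ, hρ, hb⟩ | hexit
    · obtain ⟨r, ⟨t, ht, ht0, hr, -⟩, hr'⟩ := (hfi.and_eventually (Ioo_mem_nhdsLT hρ)).exists
      have := hb t ht ht0
      rw [hr] at this
      exact absurd hr'.1 (not_lt.mpr this)
    · obtain ⟨t₀, ht₀, ht₀0, hlate⟩ := hexit r₀ hr₀R
      obtain ⟨M, hMR, hM⟩ : ∃ M < R, ∀ t ∈ Icc 0 t₀, ‖η k t‖ ≤ M := by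
        have hsub : Icc 0 t₀ ⊆ K k := harc.ordConnected.out h0 ht₀
        obtain ⟨x, hx, hmax⟩ := isCompact_Icc.exists_isMaxOn (nonempty_Icc.mpr ht₀0)
          (f := fun t => ‖η k t‖) (fun t ht =>
            (harc.analytic t (hsub ht)).continuousAt.norm.continuousWithinAt)
        exact ⟨‖η k x‖, by simpa using (harc.mapsTo (hsub hx)).1, fun t ht => hmax ht⟩
      have hlatevisit : ∀ i, (∃ᶠ r in 𝓝[<] R, V i k r) → ∃ t ∈ K k, t₀ ≤ t ∧
          0 < sectorFun (θ i) (θ (i + 1)) (η k t) ∧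
          ∀ j < 2 * n + 1, j ≠ i → sectorFun (θ j) (θ (j + 1)) (η k t) < 0 := by
        intro i hfi
        obtain ⟨r, ⟨t, ht, ht0, hr, hpos⟩, hr'⟩ := (hfi.and_eventually (Ioo_mem_nhdsLT hMR)).exists
        refine ⟨t, ht, ?_, hpos⟩
        by_contra hlt
        have := hM t ⟨ht0, (not_le.mp hlt).le⟩
        rw [hr] at this
        exact absurd hr'.1 (not_lt.mpr this)
      obtain ⟨t, ht, htt, hpos, -⟩ := hlatevisit i hfi
      obtain ⟨t', ht', htt', -, hneg⟩ := hlatevisit j hfj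
      have hneg' := hneg i hi hij
      have hconn : IsPreconnected (K k ∩ Ici t₀) :=
        (harc.ordConnected.inter ordConnected_Ici).isPreconnected
      have hc : ContinuousOn (fun t => sectorFun (θ i) (θ (i + 1)) (η k t)) (K k ∩ Ici t₀) :=
        fun t ht => ((continuous_sectorFun _ _).continuousAt.comp
          (harc.analytic t ht.1).continuousAt).continuousWithinAt
      obtain ⟨τ, hτ, hτ0⟩ := hconn.intermediate_value ⟨ht', htt'⟩ ⟨ht, htt⟩ hc
        (show (0 : ℝ) ∈ Icc _ _ from ⟨hneg'.le, hpos.le⟩)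
      have hnorm := hlate τ hτ.1 hτ.2
      have hne : η k τ ≠ 0 := norm_pos_iff.mp (hr₀0.trans_lt hnorm)
      have hmem := harc.mapsTo hτ.1
      have hR' : ‖η k τ‖ < R := by simpa using hmem.1
      rcases eq_circleMap_of_sectorFun_eq_zero hne hτ0 with e | e
      · have := hr₀ _ ⟨hnorm, hR'⟩ i (by omega)
        rw [← e, hmem.2, mul_zero] at this
        exact lt_irrefl _ this
      · have := hr₀ _ ⟨hnorm, hR'⟩ (i + 1) (by omega)
        rw [← e, hmem.2, mul_zero] at this
        exact lt_irrefl _ this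
  have : Nonempty (Fin n × Bool) := ⟨(hfreq 0 (by omega)).choose⟩
  choose! k hk using hfreq
  have hinj : InjOn k (Finset.range (2 * n + 1) : Set ℕ) := by
    intro i hi j hj hij
    by_contra hne
    have hi' : i < 2 * n + 1 := by simpa using hi
    have hj' : j < 2 * n + 1 := by simpa using hj
    exact hdisj i hi' j hj' hne (k i) (hk i hi') (hij ▸ hk j hj')
  -- Pigeonhole: `2n + 1` sectors would inject into `2n` half-branches.
  have hcard := Finset.card_le_card_of_injOn (s := Finset.range (2 * n + 1))
    (t := (Finset.univ : Finset (Fin n × Bool))) k (fun _ _ => Finset.mem_univ _) hinj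
  simp at hcard
  omega

/-! ### The Poisson formula for an `L¹` boundary value. -/

section BoundaryValues

variable {u g : ℂ → ℝ} {R : ℝ}

theorem circleMap_zero_mem_ball {r s : ℝ} (h0 : 0 ≤ r) (h1 : r < R) :
    circleMap 0 r s ∈ Metric.ball (0 : ℂ) R := by
  rw [mem_ball_zero_iff, norm_circleMap_zero, abs_of_nonneg h0]
  exact h1

theorem continuous_comp_circleMap {E : Type*} [TopologicalSpace E] {u : ℂ → E}
    (hu : ContinuousOn u (Metric.ball 0 R)) {r : ℝ} (h0 : 0 ≤ r) (h1 : r < R) :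
    Continuous fun θ => u (circleMap 0 r θ) :=
  hu.comp_continuous (continuous_circleMap 0 r) fun _ => circleMap_zero_mem_ball h0 h1

theorem HasL1BoundaryValue.tendsto_integral_smul {E : Type*} [NormedAddCommGroup E]
    [NormedSpace ℝ E] (h : HasL1BoundaryValue u g R) (hR : 0 < R)
    (hu : ContinuousOn u (Metric.ball 0 R)) {K : ℝ → E} (hK : Continuous K) :
    Tendsto (fun r => ∫ θ in (0 : ℝ)..(2 * Real.pi), u (circleMap 0 r θ) • K θ) (𝓝[<] R)
      (𝓝 (∫ θ in (0 : ℝ)..(2 * Real.pi), g (circleMap 0 R θ) • K θ)) := by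
  have h2pi : (0 : ℝ) ≤ 2 * Real.pi := by positivity
  obtain ⟨C, hC⟩ := isCompact_Icc.exists_bound_of_continuousOn (s := Icc (0 : ℝ) (2 * Real.pi))
    hK.continuousOn
  have hg : IntervalIntegrable (fun θ => g (circleMap 0 R θ)) MeasureTheory.volume 0
    (2 * Real.pi) := h.1
  rw [tendsto_iff_norm_sub_tendsto_zero]
  have hlim := h.2.const_mul C
  rw [mul_zero] at hlim
  refine squeeze_zero' (Eventually.of_forall fun _ => norm_nonneg _) ?_ hlim
  filter_upwards [Ioo_mem_nhdsLT hR] with r hr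
  have hur : IntervalIntegrable (fun θ => u (circleMap 0 r θ)) MeasureTheory.volume 0
    (2 * Real.pi) := (continuous_comp_circleMap hu hr.1.le hr.2).intervalIntegrable _ _
  rw [← intervalIntegral.integral_sub (hur.smul_continuousOn hK.continuousOn)
    (hg.smul_continuousOn hK.continuousOn), ← intervalIntegral.integral_const_mul]
  refine intervalIntegral.norm_integral_le_of_norm_le h2pi ?_ ((hur.sub hg).abs.const_mul C)
  refine Eventually.of_forall fun θ hθ => ?_
  rw [← sub_smul, norm_smul, mul_comm, Real.norm_eq_abs]
  exact mul_le_mul_of_nonneg_right (hC θ (Ioc_subset_Icc_self hθ)) (abs_nonneg _)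

/-- The Poisson integral formula with an `L¹` boundary value. -/
theorem HasL1BoundaryValue.poisson_formula (h : HasL1BoundaryValue u g R) (hR : 0 < R)
    (hu : InnerProductSpace.HarmonicOnNhd u (Metric.ball 0 R)) {w : ℂ}
    (hw : w ∈ Metric.ball (0 : ℂ) R) :
    u w = (2 * Real.pi)⁻¹ * ∫ θ in (0 : ℝ)..(2 * Real.pi),
      g (circleMap 0 R θ) • poissonKernel 0 w (circleMap 0 R θ) := by
  have hcont : ContinuousOn u (Metric.ball 0 R) := hu.contDiffOn.continuousOn
  have hwn : ‖w‖ < R := by simpa using hw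
  have hK : Continuous fun θ => poissonKernel 0 w (circleMap 0 R θ) := by
    unfold poissonKernel
    refine Continuous.div (by fun_prop) (by fun_prop) fun θ => ?_
    have : circleMap 0 R θ - w ≠ 0 := by
      intro e
      have h1 : ‖circleMap 0 R θ‖ = R := by rw [norm_circleMap_zero, abs_of_pos hR]
      rw [sub_eq_zero.mp e] at h1
      exact hwn.ne h1
    simpa using this
  have h1 := (h.tendsto_integral_smul hR hcont hK).const_mul (2 * Real.pi)⁻¹
  -- Evaluating at `(ρ / R) w` rather than at `w` keeps the kernel independent of `ρ`, because the
  -- Poisson kernel is invariant under dilations.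
  have h2 : Tendsto (fun ρ : ℝ => u (((ρ / R : ℝ) : ℂ) * w)) (𝓝[<] R) (𝓝 (u w)) := by
    have hc : Tendsto (fun ρ : ℝ => ((ρ / R : ℝ) : ℂ) * w) (𝓝[<] R) (𝓝 w) := by
      have : ContinuousAt (fun ρ : ℝ => ((ρ / R : ℝ) : ℂ) * w) R := by fun_prop
      have h3 := this.tendsto
      rw [div_self hR.ne', Complex.ofReal_one, one_mul] at h3
      exact h3.mono_left nhdsWithin_le_nhds
    exact (hcont.continuousAt (Metric.isOpen_ball.mem_nhds hw)).tendsto.comp hc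
  refine tendsto_nhds_unique h2 (h1.congr' ?_)
  filter_upwards [Ioo_mem_nhdsLT hR] with ρ hρ
  have hq : 0 < ρ / R := div_pos hρ.1 hR
  have hsub : Metric.closedBall (0 : ℂ) ρ ⊆ Metric.ball 0 R := Metric.closedBall_subset_ball hρ.2
  have hmem : ((ρ / R : ℝ) : ℂ) * w ∈ Metric.ball (0 : ℂ) ρ := by
    rw [mem_ball_zero_iff, norm_mul, Complex.norm_real, Real.norm_of_nonneg hq.le, div_mul_eq_mul_div,
      div_lt_iff₀ hR]
    exact mul_lt_mul_of_pos_left hwn hρ.1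
  rw [← (hu.mono hsub).circleAverage_poissonKernel_smul hmem, Real.circleAverage, smul_eq_mul]
  congr 1
  refine intervalIntegral.integral_congr fun θ _ => ?_
  simp only [Pi.smul_apply', smul_eq_mul]
  rw [mul_comm]
  congr 1
  have e : circleMap 0 ρ θ = ((ρ / R : ℝ) : ℂ) * circleMap 0 R θ := by
    simp only [circleMap_zero]
    have : (R : ℂ) ≠ 0 := by exact_mod_cast hR.ne'
    push_cast
    field_simp
  simp only [poissonKernel, sub_zero]
  rw [e, ← mul_sub, norm_mul, norm_mul, norm_mul, mul_pow, mul_pow, mul_pow, ← mul_sub,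
    Complex.norm_real, Real.norm_of_nonneg hq.le, mul_div_mul_left _ _ (by positivity)]

end BoundaryValues

/-! ### The Poisson kernel in polar coordinates and Fatou's theorem. -/

/-- The Poisson kernel of the disc of radius `R` in polar coordinates. -/
noncomputable def polarPoissonKernel (R r s : ℝ) : ℝ := (R ^ 2 - r ^ 2) / (R ^ 2 + r ^ 2 - 2 * R * r * Real.cos s)

theorem poissonKernel_circleMap {R r : ℝ} (φ θ : ℝ) :
    poissonKernel 0 (circleMap 0 r φ) (circleMap 0 R θ) = polarPoissonKernel R r (θ - φ) := by
  have h1 : ‖circleMap 0 R θ - circleMap 0 r φ‖ ^ 2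
      = R ^ 2 + r ^ 2 - 2 * R * r * Real.cos (θ - φ) := by
    rw [← Complex.normSq_eq_norm_sq, Complex.normSq_apply, Real.cos_sub]
    simp only [circleMap_zero, Complex.sub_re, Complex.sub_im, Complex.re_ofReal_mul,
      Complex.im_ofReal_mul, Complex.exp_ofReal_mul_I_re, Complex.exp_ofReal_mul_I_im]
    have a := Real.sin_sq_add_cos_sq θ
    have b := Real.sin_sq_add_cos_sq φ
    linear_combination R ^ 2 * a + r ^ 2 * b
  rw [poissonKernel, polarPoissonKernel, sub_zero, sub_zero, h1, norm_circleMap_zero,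
    norm_circleMap_zero, sq_abs, sq_abs]

section PolarPoissonKernel

variable {R r : ℝ}

theorem polarPoissonKernel_denom_pos (hr : 0 < r) (hrR : r < R) (s : ℝ) :
    0 < R ^ 2 + r ^ 2 - 2 * R * r * Real.cos s := by
  have h1 := Real.cos_le_one s
  have h2 : 0 < R * r := mul_pos (hr.trans hrR) hr
  nlinarith [sq_pos_of_pos (sub_pos.mpr hrR)]

theorem polarPoissonKernel_pos (hr : 0 < r) (hrR : r < R) (s : ℝ) :
    0 < polarPoissonKernel R r s :=
  div_pos (by nlinarith) (polarPoissonKernel_denom_pos hr hrR s)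

theorem hasDerivAt_polarPoissonKernel (hr : 0 < r) (hrR : r < R) (s : ℝ) :
    HasDerivAt (polarPoissonKernel R r)
      (-((R ^ 2 - r ^ 2) * (2 * R * r * Real.sin s)) /
        (R ^ 2 + r ^ 2 - 2 * R * r * Real.cos s) ^ 2) s := by
  have h1 : HasDerivAt (fun s => R ^ 2 + r ^ 2 - 2 * R * r * Real.cos s)
      (2 * R * r * Real.sin s) s := by
    have := ((Real.hasDerivAt_cos s).const_mul (2 * R * r)).const_sub (R ^ 2 + r ^ 2)
    convert! this using 1
    ring
  have := (hasDerivAt_const s (R ^ 2 - r ^ 2)).div h1 (polarPoissonKernel_denom_pos hr hrR s).ne'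
  convert! this using 1
  ring

theorem contDiff_polarPoissonKernel (hr : 0 < r) (hrR : r < R) :
    ContDiff ℝ 1 (polarPoissonKernel R r) := by
  unfold polarPoissonKernel
  exact ContDiff.div (by fun_prop) (by fun_prop)
    fun s => (polarPoissonKernel_denom_pos hr hrR s).ne'

theorem integral_polarPoissonKernel (hr : 0 < r) (hrR : r < R) (φ : ℝ) :
    ∫ t in (0 : ℝ)..(2 * Real.pi), polarPoissonKernel R r (t - φ) = 2 * Real.pi := by
  have h1 : InnerProductSpace.HarmonicOnNhd (fun _ : ℂ => (1 : ℝ)) (Metric.closedBall 0 R) :=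
    fun z _ => by simp
  have h2 := h1.circleAverage_poissonKernel_smul
    (circleMap_zero_mem_ball (s := φ) hr.le hrR)
  rw [Real.circleAverage, smul_eq_mul, inv_mul_eq_iff_eq_mul₀ (by positivity), mul_one] at h2
  refine Eq.trans (intervalIntegral.integral_congr fun θ _ => ?_) h2
  simp [poissonKernel_circleMap]

theorem tendsto_polarPoissonKernel_zero (hR : 0 < R) {s : ℝ} (hs : Real.cos s ≠ 1) :
    Tendsto (fun r => polarPoissonKernel R r s) (𝓝[<] R) (𝓝 0) := by
  have hne : R ^ 2 + R ^ 2 - 2 * R * R * Real.cos s ≠ 0 := by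
    have : R ^ 2 + R ^ 2 - 2 * R * R * Real.cos s = 2 * R ^ 2 * (1 - Real.cos s) := by ring
    rw [this]
    exact mul_ne_zero (by positivity) (sub_ne_zero.mpr hs.symm)
  have : ContinuousAt (fun r => polarPoissonKernel R r s) R := by
    unfold polarPoissonKernel
    exact ContinuousAt.div (by fun_prop) (by fun_prop) hne
  have h := this.tendsto
  simp only [polarPoissonKernel, sub_self, zero_div] at h
  exact h.mono_left nhdsWithin_le_nhds

/-- The derivative of the Poisson kernel at distance at least `δ` from the pole. -/
theorem abs_deriv_polarPoissonKernel_le (hr : 0 < r) (hrR : r < R) (hr2 : R / 2 ≤ r) {c s : ℝ}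
    (hc : 0 < c) (hs : c ≤ 1 - Real.cos s) :
    |deriv (polarPoissonKernel R r) s| ≤ (R ^ 2 - r ^ 2) * (2 / (R ^ 2 * c ^ 2)) := by
  have hR : 0 < R := hr.trans hrR
  have hD := polarPoissonKernel_denom_pos hr hrR s
  have h1 : 0 < R ^ 2 - r ^ 2 := by nlinarith
  have hDc : R ^ 2 * c ≤ R ^ 2 + r ^ 2 - 2 * R * r * Real.cos s := by
    have e : R ^ 2 + r ^ 2 - 2 * R * r * Real.cos s
        = (R - r) ^ 2 + 2 * R * r * (1 - Real.cos s) := by ring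
    have h2 : R ^ 2 * c ≤ 2 * R * r * (1 - Real.cos s) := by
      have : R ^ 2 ≤ 2 * R * r := by nlinarith
      exact mul_le_mul this hs hc.le (by positivity)
    rw [e]
    nlinarith [sq_nonneg (R - r)]
  rw [(hasDerivAt_polarPoissonKernel hr hrR s).deriv, abs_div, abs_neg, abs_mul, abs_of_pos h1,
    abs_of_pos (pow_pos hD 2), mul_div_assoc]
  refine mul_le_mul_of_nonneg_left ?_ h1.le
  have h3 : |2 * R * r * Real.sin s| ≤ 2 * R ^ 2 := by
    rw [abs_mul, abs_of_pos (by positivity : 0 < 2 * R * r)]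
    calc 2 * R * r * |Real.sin s| ≤ 2 * R * r * 1 :=
          mul_le_mul_of_nonneg_left (Real.abs_sin_le_one s) (by positivity)
      _ ≤ 2 * R ^ 2 := by nlinarith
  calc |2 * R * r * Real.sin s| / (R ^ 2 + r ^ 2 - 2 * R * r * Real.cos s) ^ 2
      ≤ 2 * R ^ 2 / (R ^ 2 * c) ^ 2 := by gcongr
    _ = 2 / (R ^ 2 * c ^ 2) := by field_simp

/-- **Fatou's theorem** at a point where the primitive of the boundary value is differentiable. -/
theorem tendsto_integral_polarPoissonKernel (hR : 0 < R) {G : ℝ → ℝ}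
    (hG : IntervalIntegrable G MeasureTheory.volume 0 (2 * Real.pi)) {φ : ℝ}
    (hφ : φ ∈ Ioo 0 (2 * Real.pi)) (hd : HasDerivAt (fun x => ∫ t in φ..x, G t) (G φ) φ) :
    Tendsto (fun r => ∫ t in (0 : ℝ)..(2 * Real.pi), polarPoissonKernel R r (t - φ) * G t) (𝓝[<] R)
      (𝓝 (2 * Real.pi * G φ)) := by
  have hpi := Real.pi_pos
  have hIcc : uIcc 0 (2 * Real.pi) = Icc 0 (2 * Real.pi) := uIcc_of_le (by positivity)
  have hφu : φ ∈ uIcc 0 (2 * Real.pi) := by rw [hIcc]; exact Ioo_subset_Icc_self hφ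
  -- After subtraction of the value at `φ`, the primitive `H` satisfies `H x = o(x - φ)`.
  -- Integration by parts then puts the derivative on the kernel.
  set G₀ : ℝ → ℝ := fun t => G t - G φ with hG₀def
  have hG₀ : IntervalIntegrable G₀ MeasureTheory.volume 0 (2 * Real.pi) :=
    hG.sub intervalIntegrable_const
  set H : ℝ → ℝ := fun x => ∫ t in φ..x, G₀ t with hH
  have hHac : AbsolutelyContinuousOnInterval H 0 (2 * Real.pi) :=
    hG₀.absolutelyContinuousOnInterval_intervalIntegral hφu
  have hHφ : H φ = 0 := by simp [hH]
  have hHd : HasDerivAt H 0 φ := by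
    have h1 : HasDerivAt (fun x => (∫ t in φ..x, G t) - (x - φ) * G φ) (G φ - 1 * G φ) φ :=
      hd.sub (((hasDerivAt_id φ).sub_const φ).mul_const (G φ))
    rw [one_mul, sub_self] at h1
    refine h1.congr_of_eventuallyEq ?_
    filter_upwards [Ioo_mem_nhds hφ.1 hφ.2] with x hx
    have hxu : x ∈ uIcc 0 (2 * Real.pi) := by rw [hIcc]; exact Ioo_subset_Icc_self hx
    simp only [hH, hG₀def]
    rw [intervalIntegral.integral_sub (hG.mono_set (uIcc_subset_uIcc hφu hxu))
      intervalIntegrable_const, intervalIntegral.integral_const, smul_eq_mul]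
  obtain ⟨M, hM⟩ := hHac.exists_bound
  rw [hIcc] at hM
  have hM0 : 0 ≤ M := (norm_nonneg _).trans (hM φ (Ioo_subset_Icc_self hφ))
  have hparts : ∀ r, 0 < r → r < R →
      ∫ t in (0 : ℝ)..(2 * Real.pi), polarPoissonKernel R r (t - φ) * G t
      = 2 * Real.pi * G φ + (polarPoissonKernel R r (2 * Real.pi - φ) * H (2 * Real.pi)
        - polarPoissonKernel R r (0 - φ) * H 0
        - ∫ t in (0 : ℝ)..(2 * Real.pi), deriv (polarPoissonKernel R r) (t - φ) * H t) := by
    intro r hr hrR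
    have hKc : ContDiff ℝ 1 fun t => polarPoissonKernel R r (t - φ) :=
      (contDiff_polarPoissonKernel hr hrR).comp (contDiff_id.sub contDiff_const)
    have hKac : AbsolutelyContinuousOnInterval (fun t => polarPoissonKernel R r (t - φ)) 0
        (2 * Real.pi) := hKc.contDiffOn.absolutelyContinuousOnInterval
    have h1 := hKac.integral_mul_deriv_eq_deriv_mul hHac
    have h2 : ∫ t in (0 : ℝ)..(2 * Real.pi), polarPoissonKernel R r (t - φ) * deriv H t
        = ∫ t in (0 : ℝ)..(2 * Real.pi), polarPoissonKernel R r (t - φ) * G₀ t := by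
      refine intervalIntegral.integral_congr_ae ?_
      filter_upwards [hG₀.ae_hasDerivAt_integral] with x hx hx'
      rw [(hx (uIoc_subset_uIcc hx') φ hφu).deriv]
    have h3 : ∫ t in (0 : ℝ)..(2 * Real.pi), polarPoissonKernel R r (t - φ) * G t
        = (∫ t in (0 : ℝ)..(2 * Real.pi), polarPoissonKernel R r (t - φ) * G₀ t)
          + (∫ t in (0 : ℝ)..(2 * Real.pi), polarPoissonKernel R r (t - φ)) * G φ := by
      have i₂ : IntervalIntegrable (fun t => polarPoissonKernel R r (t - φ) * G φ)
          MeasureTheory.volume 0 (2 * Real.pi) :=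
        (hKc.continuous.mul continuous_const).intervalIntegrable _ _
      rw [← intervalIntegral.integral_mul_const, ← intervalIntegral.integral_add
        (hG₀.continuousOn_mul hKc.continuous.continuousOn) i₂]
      refine intervalIntegral.integral_congr fun t _ => ?_
      simp only [hG₀def]
      ring
    rw [h3, integral_polarPoissonKernel hr hrR, ← h2, h1]
    simp only [deriv_comp_sub_const]
    ring
  have hcos : ∀ s ∈ Icc (-φ) (2 * Real.pi - φ), s ≠ 0 → 0 < 1 - Real.cos s := by
    intro s hs hs0
    refine sub_pos.mpr (lt_of_le_of_ne (Real.cos_le_one s) fun e => hs0 ?_)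
    exact (Real.cos_eq_one_iff_of_lt_of_lt (by linarith [hs.1, hφ.2]) (by linarith [hs.2, hφ.1])).mp e
  have hsmall : Tendsto (fun r => ∫ t in (0 : ℝ)..(2 * Real.pi),
      deriv (polarPoissonKernel R r) (t - φ) * H t) (𝓝[<] R) (𝓝 0) := by
    rw [Metric.tendsto_nhds]
    intro ε' hε'
    -- Chosen so that the near part, which costs `ε * 2π`, amounts to `ε' / 2`.
    set ε := ε' / (4 * Real.pi) with hεdef
    have hε : 0 < ε := by positivity
    have hnear : ∀ᶠ t in 𝓝 φ, |H t| ≤ ε * |t - φ| := by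
      have := (hasDerivAt_iff_isLittleO.mp hHd).def hε
      simpa [hHφ] using this
    obtain ⟨δ₀, hδ₀, hδball⟩ := Metric.eventually_nhds_iff_ball.mp hnear
    -- The bound `δ ≤ π` makes `sin s` share the sign of `s`, so that `-(s * P' s) ≥ 0` near the
    -- pole.
    set δ := min δ₀ Real.pi with hδdef
    have hδ : 0 < δ := lt_min hδ₀ hpi
    obtain ⟨c, hc, hcδ⟩ : ∃ c > 0, ∀ s ∈ Icc (-φ) (2 * Real.pi - φ), δ ≤ |s| →
        c ≤ 1 - Real.cos s := by
      set S := Icc (-φ) (2 * Real.pi - φ) ∩ {s | δ ≤ |s|} with hS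
      have hScomp : IsCompact S :=
        isCompact_Icc.inter_right (isClosed_le continuous_const continuous_abs)
      rcases S.eq_empty_or_nonempty with he | hne
      · refine ⟨1, one_pos, fun s hs hsδ => ?_⟩
        have : s ∈ S := ⟨hs, hsδ⟩
        rw [he] at this
        exact absurd this (notMem_empty s)
      · obtain ⟨x, hx, hmin⟩ := hScomp.exists_isMinOn hne
          (f := fun s => 1 - Real.cos s) (by fun_prop)
        refine ⟨1 - Real.cos x, hcos x hx.1 fun e => ?_, fun s hs hsδ => hmin ⟨hs, hsδ⟩⟩
        have : δ ≤ |x| := hx.2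
        rw [e, abs_zero] at this
        exact absurd this (not_le.mpr hδ)
    -- Bound for the part away from `φ`. The summand `ε * (2π)` pays for `-(s * P' s)`, which may be
    -- negative there; the factor `R² - r²` sends `B` to `0`.
    set B : ℝ → ℝ := fun r => (R ^ 2 - r ^ 2) * (2 / (R ^ 2 * c ^ 2)) * (M + ε * (2 * Real.pi))
      with hB
    have hBlim : Tendsto (fun r => 2 * Real.pi * B r) (𝓝[<] R) (𝓝 0) := by
      have : Continuous fun r => 2 * Real.pi * B r := by fun_prop
      have h := this.tendsto R
      simp only [hB, sub_self, zero_mul, mul_zero] at h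
      exact h.mono_left nhdsWithin_le_nhds
    have hε2 : (0 : ℝ) < ε' / 2 := by positivity
    filter_upwards [Ioo_mem_nhdsLT (half_lt_self hR), hBlim.eventually (gt_mem_nhds hε2)]
      with r hr hBr
    have hr0 : 0 < r := (half_pos hR).trans hr.1
    have hrR : r < R := hr.2
    have h1 : 0 < R ^ 2 - r ^ 2 := by nlinarith
    have hB0 : 0 ≤ B r := by simp only [hB]; positivity
    have hdc : Continuous (deriv (polarPoissonKernel R r)) :=
      (contDiff_polarPoissonKernel hr0 hrR).continuous_deriv le_rfl
    have hpt : ∀ t ∈ Icc 0 (2 * Real.pi), |deriv (polarPoissonKernel R r) (t - φ) * H t|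
        ≤ ε * (-((t - φ) * deriv (polarPoissonKernel R r) (t - φ))) + B r := by
      intro t ht
      rw [abs_mul]
      have hts : t - φ ∈ Icc (-φ) (2 * Real.pi - φ) := ⟨by linarith [ht.1], by linarith [ht.2]⟩
      rcases lt_or_ge |t - φ| δ with hlt | hge
      · have hsin : 0 ≤ (t - φ) * Real.sin (t - φ) := by
          have hlt' := abs_lt.mp (hlt.trans_le (min_le_right _ _))
          rcases le_total 0 (t - φ) with h0 | h0
          · exact mul_nonneg h0 (Real.sin_nonneg_of_nonneg_of_le_pi h0 hlt'.2.le)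
          · exact mul_nonneg_of_nonpos_of_nonpos h0
              (Real.sin_nonpos_of_nonpos_of_neg_pi_le h0 hlt'.1.le)
        have hsign : (t - φ) * deriv (polarPoissonKernel R r) (t - φ) ≤ 0 := by
          rw [(hasDerivAt_polarPoissonKernel hr0 hrR _).deriv, ← mul_div_assoc]
          refine div_nonpos_of_nonpos_of_nonneg ?_ (sq_nonneg _)
          have : (t - φ) * -((R ^ 2 - r ^ 2) * (2 * R * r * Real.sin (t - φ)))
              = -((R ^ 2 - r ^ 2) * (2 * R * r) * ((t - φ) * Real.sin (t - φ))) := by ring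
          rw [this]
          exact neg_nonpos.mpr (by positivity)
        have hHt : |H t| ≤ ε * |t - φ| := hδball t (by
          rw [Metric.mem_ball, Real.dist_eq]
          exact hlt.trans_le (min_le_left _ _))
        calc |deriv (polarPoissonKernel R r) (t - φ)| * |H t|
            ≤ |deriv (polarPoissonKernel R r) (t - φ)| * (ε * |t - φ|) := by gcongr
          _ = ε * |(t - φ) * deriv (polarPoissonKernel R r) (t - φ)| := by rw [abs_mul]; ring
          _ = ε * (-((t - φ) * deriv (polarPoissonKernel R r) (t - φ))) := by
              rw [abs_of_nonpos hsign]
          _ ≤ _ := le_add_of_nonneg_right hB0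
      · have hder := abs_deriv_polarPoissonKernel_le hr0 hrR hr.1.le hc (hcδ _ hts hge)
        have hts2 : |t - φ| ≤ 2 * Real.pi :=
          abs_le.mpr ⟨by linarith [hts.1, hφ.2], by linarith [hts.2, hφ.1]⟩
        have hHt : |H t| ≤ M := hM t ht
        have e1 : (t - φ) * deriv (polarPoissonKernel R r) (t - φ)
            ≤ 2 * Real.pi * |deriv (polarPoissonKernel R r) (t - φ)| := by
          refine (le_abs_self _).trans ?_
          rw [abs_mul]
          gcongr
        have e2 : |deriv (polarPoissonKernel R r) (t - φ)| * (M + ε * (2 * Real.pi)) ≤ B r := by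
          simp only [hB]
          gcongr
        have e3 : |deriv (polarPoissonKernel R r) (t - φ)| * |H t|
            ≤ |deriv (polarPoissonKernel R r) (t - φ)| * M := by gcongr
        have e4 := mul_le_mul_of_nonneg_left e1 hε.le
        linarith
    -- By parts, the integral equals that of the kernel minus two nonnegative boundary terms.
    have hparts2 : ∫ t in (0 : ℝ)..(2 * Real.pi),
        -((t - φ) * deriv (polarPoissonKernel R r) (t - φ)) ≤ 2 * Real.pi := by
      have hp := intervalIntegral.integral_mul_deriv_eq_deriv_mul
        (u := fun t => t - φ) (v := fun t => polarPoissonKernel R r (t - φ)) (u' := fun _ => 1)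
        (v' := fun t => deriv (polarPoissonKernel R r) (t - φ)) (a := 0) (b := 2 * Real.pi)
        (fun t _ => (hasDerivAt_id t).sub_const φ)
        (fun t _ => by
          have h5 := ((contDiff_polarPoissonKernel hr0 hrR).differentiable one_ne_zero
            (t - φ)).hasDerivAt
          exact h5.comp_sub_const t φ)
        intervalIntegrable_const
        ((hdc.comp (continuous_id.sub continuous_const)).intervalIntegrable _ _)
      simp only [one_mul] at hp
      rw [integral_polarPoissonKernel hr0 hrR] at hp
      rw [intervalIntegral.integral_neg, hp]
      have p1 := polarPoissonKernel_pos hr0 hrR (2 * Real.pi - φ)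
      have p2 := polarPoissonKernel_pos hr0 hrR (0 - φ)
      nlinarith [hφ.1, hφ.2, mul_pos (sub_pos.mpr hφ.2) p1, mul_pos hφ.1 p2]
    rw [dist_zero_right]
    have hci : IntervalIntegrable (fun t => -((t - φ) * deriv (polarPoissonKernel R r) (t - φ)))
        MeasureTheory.volume 0 (2 * Real.pi) :=
      Continuous.intervalIntegrable (by fun_prop) _ _
    calc ‖∫ t in (0 : ℝ)..(2 * Real.pi), deriv (polarPoissonKernel R r) (t - φ) * H t‖
        ≤ ∫ t in (0 : ℝ)..(2 * Real.pi),
          (ε * (-((t - φ) * deriv (polarPoissonKernel R r) (t - φ))) + B r) :=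
          intervalIntegral.norm_integral_le_of_norm_le (by positivity)
            (Eventually.of_forall fun t ht => hpt t (Ioc_subset_Icc_self ht))
            ((hci.const_mul ε).add intervalIntegrable_const)
      _ = ε * (∫ t in (0 : ℝ)..(2 * Real.pi),
            -((t - φ) * deriv (polarPoissonKernel R r) (t - φ))) + 2 * Real.pi * B r := by
          rw [intervalIntegral.integral_add (hci.const_mul ε) intervalIntegrable_const,
            intervalIntegral.integral_const_mul, intervalIntegral.integral_const, sub_zero,
            smul_eq_mul]
      _ ≤ ε * (2 * Real.pi) + 2 * Real.pi * B r := by gcongr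
      _ < ε' / 2 + ε' / 2 := by
          have : ε * (2 * Real.pi) = ε' / 2 := by rw [hεdef]; field_simp; ring
          linarith
      _ = ε' := by ring
  have hb1 : Real.cos (2 * Real.pi - φ) ≠ 1 := by
    have := hcos (2 * Real.pi - φ) ⟨by linarith, le_rfl⟩ (by linarith [hφ.2])
    intro e
    linarith
  have hb2 : Real.cos (0 - φ) ≠ 1 := by
    have := hcos (0 - φ) ⟨by linarith, by linarith⟩ (by linarith [hφ.1])
    intro e
    linarith
  have hlim := (((tendsto_polarPoissonKernel_zero hR hb1).mul_const (H (2 * Real.pi))).sub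
    ((tendsto_polarPoissonKernel_zero hR hb2).mul_const (H 0))).sub hsmall
  have hlim2 := hlim.const_add (2 * Real.pi * G φ)
  simp only [zero_mul, sub_zero, add_zero] at hlim2
  refine hlim2.congr' ?_
  filter_upwards [Ioo_mem_nhdsLT hR] with r hr
  rw [hparts r hr.1 hr.2]

end PolarPoissonKernel

/-- **Fatou's theorem**: a harmonic function with an `L¹` boundary value has this value as its
radial limit almost everywhere. -/
theorem HasL1BoundaryValue.ae_tendsto {u g : ℂ → ℝ} {R : ℝ} (h : HasL1BoundaryValue u g R)
    (hR : 0 < R) (hu : InnerProductSpace.HarmonicOnNhd u (Metric.ball 0 R)) :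
    ∀ᵐ φ, φ ∈ Ioo 0 (2 * Real.pi) →
      Tendsto (fun r => u (circleMap 0 r φ)) (𝓝[<] R) (𝓝 (g (circleMap 0 R φ))) := by
  have hg : IntervalIntegrable (fun θ => g (circleMap 0 R θ)) MeasureTheory.volume 0
    (2 * Real.pi) := h.1
  filter_upwards [hg.ae_hasDerivAt_integral] with φ hφ hφI
  have hφu : φ ∈ uIcc 0 (2 * Real.pi) := by
    rw [uIcc_of_le (by positivity)]
    exact Ioo_subset_Icc_self hφI
  have h1 := (tendsto_integral_polarPoissonKernel hR hg hφI (hφ hφu φ hφu)).const_mul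
    (2 * Real.pi)⁻¹
  rw [inv_mul_cancel_left₀ (by positivity)] at h1
  refine h1.congr' ?_
  filter_upwards [Ioo_mem_nhdsLT hR] with r hr
  rw [h.poisson_formula hR hu (circleMap_zero_mem_ball hr.1.le hr.2)]
  congr 1
  refine intervalIntegral.integral_congr fun θ _ => ?_
  simp only [poissonKernel_circleMap, smul_eq_mul]
  ring

/-! ### From sign changes to a trigonometric polynomial factor. -/

theorem Alternates.cons {σ : ℝ → ℝ} {E E' : Set ℝ} {N : ℕ} {ε t : ℝ} {θ : ℕ → ℝ}
    (hE : E' ⊆ E) (h : ∀ i < N, θ i ∈ E' ∧ 0 < -ε * (-1) ^ i * σ (θ i))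
    (hlt : ∀ i, i + 1 < N → θ i < θ (i + 1)) (ht : t ∈ E) (hσ : 0 < ε * σ t) (htθ : t < θ 0) :
    Alternates σ E (N + 1) ε := by
  refine ⟨fun i => Nat.casesOn i t θ, ?_, ?_⟩
  · rintro (_ | i) hi
    · exact ⟨ht, by simpa using hσ⟩
    · obtain ⟨h1, h2⟩ := h i (by omega)
      refine ⟨hE h1, ?_⟩
      simp only [pow_succ]
      linarith
  · rintro (_ | i) hi
    · exact htθ
    · exact hlt i (by omega)

/-- A function whose sign alternates at most `N` times has the sign of a product of `N` linear
factors. -/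
theorem exists_prod_nonneg_of_not_alternates {σ : ℝ → ℝ} {B : ℝ} (N : ℕ) :
    ∀ (E : Set ℝ) (A ε : ℝ), A ≤ B → E ⊆ Icc A B → ¬ Alternates σ E (N + 1) ε →
      ∃ θ : ℕ → ℝ, (∀ j, θ j ∈ Icc A B) ∧
        ∀ t ∈ E, 0 ≤ -ε * σ t * ∏ j ∈ Finset.range N, (θ j - t) := by
  induction N with
  | zero =>
    intro E A ε hAB hE h
    refine ⟨fun _ => A, fun _ => ⟨le_rfl, hAB⟩, fun t ht => ?_⟩
    by_contra hlt
    refine h ⟨fun _ => t, fun i hi => ⟨ht, ?_⟩, fun i hi => by omega⟩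
    obtain rfl : i = 0 := by omega
    simp at hlt ⊢
    exact hlt
  | succ N ih =>
    intro E A ε hAB hE h
    -- The infimum `a` of `P` is the new root. Left of `a` the sign `ε` does not occur. Right of `a`
    -- an alternating sequence starting with `-ε` could be prolonged by a point of `P` before its
    -- first term, so the induction hypothesis applies. At `a` itself the product vanishes.
    set P : Set ℝ := {t | t ∈ E ∧ 0 < ε * σ t} with hP
    have hPneg : ∀ t ∈ E, t ∉ P → 0 ≤ -ε * σ t := by
      intro t ht htP
      by_contra hlt
      exact htP ⟨ht, by linarith⟩
    rcases P.eq_empty_or_nonempty with he | hne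
    · refine ⟨fun _ => B, fun _ => ⟨hAB, le_rfl⟩, fun t ht => ?_⟩
      exact mul_nonneg (hPneg t ht (by rw [he]; exact notMem_empty t))
        (Finset.prod_nonneg fun j _ => sub_nonneg.mpr (hE ht).2)
    · have hbdd : BddBelow P := ⟨A, fun t ht => (hE ht.1).1⟩
      set a := sInf P with ha
      have hAa : A ≤ a := le_csInf hne fun t ht => (hE ht.1).1
      have haB : a ≤ B := by
        obtain ⟨t, ht⟩ := hne
        exact (csInf_le hbdd ht).trans (hE ht.1).2
      have hno : ¬ Alternates σ (E ∩ Ioi a) (N + 1) (-ε) := by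
        rintro ⟨θ, hθ, hlt⟩
        obtain ⟨t, ht, htlt⟩ := exists_lt_of_csInf_lt hne (hθ 0 (by omega)).1.2
        exact h (Alternates.cons inter_subset_left hθ hlt ht.1 ht.2 htlt)
      obtain ⟨θ, hθ, hprod⟩ := ih (E ∩ Ioi a) a (-ε) haB
        (fun t ht => ⟨le_of_lt ht.2, (hE ht.1).2⟩) hno
      refine ⟨fun j => if j < N then θ j else a, fun j => ?_, fun t ht => ?_⟩
      · beta_reduce
        split_ifs
        · exact ⟨hAa.trans (hθ j).1, (hθ j).2⟩
        · exact ⟨hAa, haB⟩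
      · have e : ∏ j ∈ Finset.range N, ((if j < N then θ j else a) - t)
            = ∏ j ∈ Finset.range N, (θ j - t) :=
          Finset.prod_congr rfl fun j hj => by rw [if_pos (Finset.mem_range.mp hj)]
        beta_reduce
        rw [Finset.prod_range_succ, e, if_neg (lt_irrefl N)]
        rcases lt_or_ge a t with hat | hat
        · have := mul_nonneg (hprod t ⟨ht, hat⟩) (sub_nonneg.mpr hat.le)
          linarith
        · rw [← mul_assoc]
          rcases hat.eq_or_lt with rfl | hat
          · simp
          · refine mul_nonneg (mul_nonneg (hPneg t ht fun htP => ?_) ?_) (sub_nonneg.mpr hat.le)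
            · exact absurd (csInf_le hbdd htP) (not_le.mpr hat)
            · exact Finset.prod_nonneg fun j _ => sub_nonneg.mpr (hat.le.trans (hθ j).1)

/-- Extracting the mean phase leaves a real sine, which has the sign of `a - t` when `|a - t| < 2π`.
This is how products of linear factors become trigonometric polynomials. -/
theorem exp_sub_exp_eq (a t : ℝ) :
    Complex.exp (t * Complex.I) - Complex.exp (a * Complex.I)
      = Complex.exp (((t + a) / 2 : ℝ) * Complex.I) * (-2 * Complex.I)
        * (Real.sin ((a - t) / 2) : ℝ) := by
  have e1 : Complex.exp (t * Complex.I) = Complex.exp (((t + a) / 2 : ℝ) * Complex.I)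
      * Complex.exp (-((a - t) / 2 : ℝ) * Complex.I) := by
    rw [← Complex.exp_add]; congr 1; push_cast; ring
  have e2 : Complex.exp (a * Complex.I) = Complex.exp (((t + a) / 2 : ℝ) * Complex.I)
      * Complex.exp (((a - t) / 2 : ℝ) * Complex.I) := by
    rw [← Complex.exp_add]; congr 1; push_cast; ring
  rw [e1, e2, ← mul_sub, mul_assoc]
  congr 1
  rw [Complex.ofReal_sin, Complex.sin]
  linear_combination (Complex.exp (-((a - t) / 2 : ℝ) * Complex.I)
    - Complex.exp (((a - t) / 2 : ℝ) * Complex.I)) * Complex.I_sq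

/-- If the nodal set consists of `n` curves through `0`, then, up to a trigonometric polynomial
factor of degree `n`, the boundary value has constant sign. -/
theorem HasL1BoundaryValue.exists_unit_roots {f : ℂ → ℂ} {u g : ℂ → ℝ} {R : ℝ} {n : ℕ}
    (hbv : HasL1BoundaryValue u g R) (hR : 0 < R)
    (hharm : InnerProductSpace.HarmonicOnNhd u (Metric.ball 0 R))
    (hf : AnalyticOnNhd ℂ f (Metric.ball 0 R)) (hu : ∀ z ∈ Metric.ball 0 R, (f z).re = u z)
    (hnc : ¬ ∃ a, ∀ z ∈ Metric.ball (0 : ℂ) R, f z = a)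
    (h : HasOnlyNodalCurvesThrough u (Metric.ball 0 R) 0 n) :
    ∃ (ζ : ℕ → ℂ) (C : ℂ), (∀ j, ‖ζ j‖ = 1) ∧ ‖C‖ = 1 ∧
      ∀ᵐ t : ℝ, t ∈ Ioo 0 (2 * Real.pi) →
        (g (circleMap 0 R t) : ℂ) * (Complex.exp (-(n * t * Complex.I))
          * ∏ j ∈ Finset.range (2 * n), (Complex.exp (t * Complex.I) - ζ j))
        = C * (‖(g (circleMap 0 R t) : ℂ)
            * ∏ j ∈ Finset.range (2 * n), (Complex.exp (t * Complex.I) - ζ j)‖ : ℝ) := by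
  set σ : ℝ → ℝ := fun t => g (circleMap 0 R t) with hσ
  set E : Set ℝ := {t | t ∈ Ioo 0 (2 * Real.pi) ∧
    Tendsto (fun r => u (circleMap 0 r t)) (𝓝[<] R) (𝓝 (σ t))} with hE
  have hno : ∀ ε, ¬ Alternates σ E (2 * n + 2) ε := by
    rintro ε ⟨θ, hθ, hmono⟩
    refine not_alternating_radii hR hf hu hnc h (θ := θ) (ε := ε) (fun i hi => ?_) hmono
    obtain ⟨h1, h2⟩ := hθ i hi
    exact ⟨h1.1, (h1.2.const_mul (ε * (-1) ^ i)).eventually (lt_mem_nhds h2)⟩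
  -- If sequences of length `2n + 1` existed for both initial signs, the earlier of the two first
  -- points could be prepended to the other sequence, giving `2n + 2` alternations. This saves one
  -- root, leaving `2n`.
  obtain ⟨s, hs, hsno⟩ : ∃ s : ℝ, (s = 1 ∨ s = -1) ∧ ¬ Alternates σ E (2 * n + 1) (-s) := by
    by_contra hall
    push Not at hall
    obtain ⟨θ, hθ, hlt⟩ := hall 1 (Or.inl rfl)
    obtain ⟨θ', hθ', hlt'⟩ := hall (-1) (Or.inr rfl)
    obtain ⟨m1, p1⟩ := hθ 0 (by omega)
    obtain ⟨m2, p2⟩ := hθ' 0 (by omega)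
    simp only [pow_zero, mul_one, neg_neg, one_mul] at p1 p2
    rcases lt_trichotomy (θ 0) (θ' 0) with hlt0 | heq | hgt
    · exact hno (-1) (Alternates.cons subset_rfl hθ' hlt' m1 p1 hlt0)
    · rw [heq] at p1
      linarith
    · exact hno 1 (Alternates.cons subset_rfl hθ hlt m2 (by rwa [one_mul]) hgt)
  obtain ⟨θ, hθ, hprod⟩ := exists_prod_nonneg_of_not_alternates (2 * n) E 0 (-s)
    (by positivity : (0 : ℝ) ≤ 2 * Real.pi) (fun t ht => Ioo_subset_Icc_self ht.1) hsno
  have hs1 : ‖(s : ℂ)‖ = 1 := by rcases hs with rfl | rfl <;> simp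
  have hs2 : (s : ℂ) * s = 1 := by rcases hs with rfl | rfl <;> simp
  set ω : ℂ := ∏ j ∈ Finset.range (2 * n), Complex.exp ((θ j / 2 : ℝ) * Complex.I) with hω
  have hω1 : ‖ω‖ = 1 := by
    rw [hω, norm_prod]
    exact Finset.prod_eq_one fun j _ => Complex.norm_exp_ofReal_mul_I _
  refine ⟨fun j => Complex.exp (θ j * Complex.I), s * (ω * (-1) ^ n),
    fun j => Complex.norm_exp_ofReal_mul_I _, by rw [norm_mul, norm_mul, hs1, hω1]; simp, ?_⟩
  filter_upwards [hbv.ae_tendsto hR hharm] with t ht htI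
  have htE : t ∈ E := ⟨htI, ht htI⟩
  set S : ℝ := ∏ j ∈ Finset.range (2 * n), Real.sin ((θ j - t) / 2) with hS
  have hsgn : 0 ≤ s * σ t * S := by
    have h1 : S = (∏ j ∈ Finset.range (2 * n), (θ j - t))
        * ∏ j ∈ Finset.range (2 * n), (Real.sin ((θ j - t) / 2) / (θ j - t)) := by
      rw [hS, ← Finset.prod_mul_distrib]
      refine Finset.prod_congr rfl fun j _ => ?_
      rcases eq_or_ne (θ j - t) 0 with h0 | h0
      · simp [h0]
      · rw [mul_div_cancel₀ _ h0]
    rw [h1, ← mul_assoc]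
    have h2 := hprod t htE
    rw [neg_neg] at h2
    refine mul_nonneg h2 (Finset.prod_nonneg fun j _ => ?_)
    have b1 := hθ j
    rcases le_total 0 (θ j - t) with h0 | h0
    · exact div_nonneg (Real.sin_nonneg_of_nonneg_of_le_pi (by linarith)
        (by linarith [b1.2, htI.1])) h0
    · exact div_nonneg_of_nonpos (Real.sin_nonpos_of_nonpos_of_neg_pi_le (by linarith)
        (by linarith [b1.1, htI.2])) h0
  -- The `2n` half-phases `exp (i t / 2)` combine to `exp (i n t)`, which the factor `exp (-i n t)`
  -- of the statement removes; what remains depends on `t` only through the real number `S`.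
  have hfac : ∏ j ∈ Finset.range (2 * n), (Complex.exp (t * Complex.I)
      - Complex.exp (θ j * Complex.I))
      = Complex.exp (n * t * Complex.I) * (ω * (-4) ^ n) * (S : ℂ) := by
    have e : ∀ j, Complex.exp (t * Complex.I) - Complex.exp (θ j * Complex.I)
        = Complex.exp ((t / 2 : ℝ) * Complex.I) * Complex.exp ((θ j / 2 : ℝ) * Complex.I)
          * (-2 * Complex.I) * (Real.sin ((θ j - t) / 2) : ℝ) := by
      intro j
      rw [exp_sub_exp_eq, ← Complex.exp_add]
      congr 3
      push_cast
      ring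
    simp only [e, Finset.prod_mul_distrib, Finset.prod_const, Finset.card_range]
    rw [← hω, hS, Complex.ofReal_prod, ← Complex.exp_nat_mul]
    have e2 : (-2 : ℂ) ^ (2 * n) * Complex.I ^ (2 * n) = (-4) ^ n := by
      rw [pow_mul, pow_mul, Complex.I_sq, ← mul_pow]; norm_num
    have e3 : ((2 * n : ℕ) : ℂ) * (((t / 2 : ℝ) : ℂ) * Complex.I) = n * t * Complex.I := by
      push_cast; ring
    rw [e2, e3]
    ring
  have hnorm : ‖(σ t : ℂ) * (Complex.exp (n * t * Complex.I) * (ω * (-4) ^ n) * (S : ℂ))‖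
      = s * σ t * S * 4 ^ n := by
    have e1 : ‖Complex.exp (n * t * Complex.I)‖ = 1 := by
      have := Complex.norm_exp_ofReal_mul_I (n * t)
      rwa [Complex.ofReal_mul, Complex.ofReal_natCast] at this
    have e2 : |s * σ t * S| = |σ t| * |S| := by
      rw [abs_mul, abs_mul, ← Real.norm_eq_abs s, ← Complex.norm_real, hs1, one_mul]
    rw [← abs_of_nonneg hsgn, e2]
    simp only [norm_mul, e1, hω1, norm_pow, norm_neg, Complex.norm_real, Real.norm_eq_abs, one_mul,
      Complex.norm_ofNat]
    ring
  change (σ t : ℂ) * _ = _ * ((‖(σ t : ℂ) * _‖ : ℝ) : ℂ)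
  rw [hfac, hnorm]
  have e3 : Complex.exp (-(n * t * Complex.I)) * Complex.exp (n * t * Complex.I) = 1 := by
    rw [← Complex.exp_add]; simp
  have e4 : ((-4 : ℂ)) ^ n = (-1) ^ n * 4 ^ n := by rw [← mul_pow]; norm_num
  push_cast
  rw [e4]
  linear_combination (σ t : ℂ) * ω * (-1) ^ n * 4 ^ n * S * (e3 - hs2)

/-! ### Fourier coefficients of the boundary value and Taylor coefficients. -/

section FourierCoefficients

variable {f : ℂ → ℂ} {u g : ℂ → ℝ} {R : ℝ}

/-- The `k`-th Taylor coefficient of `f` at `0`. -/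
noncomputable def taylorCoeff (f : ℂ → ℂ) (k : ℕ) : ℂ := iteratedDeriv k f 0 / k.factorial

theorem integral_circleMap_mul_exp_neg (hf : DifferentiableOn ℂ f (Metric.ball 0 R)) {r : ℝ}
    (hr : 0 < r) (hrR : r < R) (k : ℕ) :
    ∫ θ in (0 : ℝ)..(2 * Real.pi), f (circleMap 0 r θ) * Complex.exp (-(k * θ * Complex.I))
      = 2 * Real.pi * r ^ k * taylorCoeff f k := by
  have h1 : DiffContOnCl ℂ f (Metric.ball 0 r) :=
    (hf.mono ((closure_ball (0 : ℂ) hr.ne').symm ▸ Metric.closedBall_subset_ball hrR)).diffContOnCl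
  have h2 := h1.circleIntegral_one_div_sub_center_pow_smul hr k
  have hr0 : (r : ℂ) ≠ 0 := by exact_mod_cast hr.ne'
  have h3 : ∀ θ : ℝ, deriv (circleMap 0 r) θ • (1 / (circleMap 0 r θ - 0) ^ (k + 1))
      • f (circleMap 0 r θ)
      = Complex.I / r ^ k * (f (circleMap 0 r θ) * Complex.exp (-(k * θ * Complex.I))) := by
    intro θ
    have e : Complex.exp (-(k * θ * Complex.I)) = (Complex.exp (θ * Complex.I) ^ k)⁻¹ := by
      rw [← Complex.exp_nat_mul, ← Complex.exp_neg]
      ring_nf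
    rw [deriv_circleMap, e, circleMap_zero, sub_zero, smul_eq_mul, smul_eq_mul]
    have := Complex.exp_ne_zero (θ * Complex.I)
    field_simp
    ring
  rw [circleIntegral, intervalIntegral.integral_congr (fun θ _ => h3 θ),
    intervalIntegral.integral_const_mul] at h2
  rw [taylorCoeff]
  have hI := Complex.I_ne_zero
  have hk : (k.factorial : ℂ) ≠ 0 := by exact_mod_cast k.factorial_ne_zero
  rw [smul_eq_mul] at h2
  field_simp at h2 ⊢
  linear_combination h2

theorem integral_circleMap_mul_exp (hf : DifferentiableOn ℂ f (Metric.ball 0 R)) {r : ℝ}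
    (hr : 0 < r) (hrR : r < R) {k : ℕ} (hk : 1 ≤ k) :
    ∫ θ in (0 : ℝ)..(2 * Real.pi), f (circleMap 0 r θ) * Complex.exp (k * θ * Complex.I) = 0 := by
  have h1 : DiffContOnCl ℂ (fun z => z ^ (k - 1) * f z) (Metric.ball 0 r) := by
    refine DifferentiableOn.diffContOnCl ?_
    exact (differentiableOn_id.pow _).mul
      (hf.mono ((closure_ball (0 : ℂ) hr.ne').symm ▸ Metric.closedBall_subset_ball hrR))
  have h2 := h1.circleIntegral_eq_zero hr.le
  have hr0 : (r : ℂ) ≠ 0 := by exact_mod_cast hr.ne'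
  have h3 : ∀ θ : ℝ, deriv (circleMap 0 r) θ • (circleMap 0 r θ ^ (k - 1) * f (circleMap 0 r θ))
      = Complex.I * r ^ k * (f (circleMap 0 r θ) * Complex.exp (k * θ * Complex.I)) := by
    intro θ
    have e : Complex.exp (k * θ * Complex.I) = Complex.exp (θ * Complex.I) ^ k := by
      rw [← Complex.exp_nat_mul]
      ring_nf
    obtain ⟨j, rfl⟩ : ∃ j, k = j + 1 := ⟨k - 1, by omega⟩
    rw [deriv_circleMap, e, circleMap_zero, smul_eq_mul, Nat.add_sub_cancel]
    ring
  rw [circleIntegral, intervalIntegral.integral_congr (fun θ _ => h3 θ),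
    intervalIntegral.integral_const_mul] at h2
  exact (mul_eq_zero.mp h2).resolve_left (mul_ne_zero Complex.I_ne_zero (pow_ne_zero k hr0))

/-- Write `Re f` as half of `f` plus its conjugate. The first half gives the Taylor coefficient by
Cauchy's formula and the second vanishes by Cauchy's theorem; for `k = 0` the latter needs a zero
constant term. -/
theorem integral_re_circleMap_mul_exp_neg (hf : DifferentiableOn ℂ f (Metric.ball 0 R)) {r : ℝ}
    (hr : 0 < r) (hrR : r < R) {k : ℕ} (h : 1 ≤ k ∨ taylorCoeff f 0 = 0) :
    ∫ θ in (0 : ℝ)..(2 * Real.pi), (f (circleMap 0 r θ)).re • Complex.exp (-(k * θ * Complex.I))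
      = Real.pi * r ^ k * taylorCoeff f k := by
  have h1 := integral_circleMap_mul_exp_neg hf hr hrR k
  have h2 : ∫ θ in (0 : ℝ)..(2 * Real.pi),
      f (circleMap 0 r θ) * Complex.exp (k * θ * Complex.I) = 0 := by
    rcases Nat.eq_zero_or_pos k with rfl | hk
    · have h0 : taylorCoeff f 0 = 0 := h.resolve_left (by omega)
      rw [h0] at h1
      simpa using h1
    · exact integral_circleMap_mul_exp hf hr hrR hk
  have hc : Continuous fun θ => f (circleMap 0 r θ) :=
    continuous_comp_circleMap hf.continuousOn hr.le hrR
  have e : ∀ θ : ℝ, (f (circleMap 0 r θ)).re • Complex.exp (-(k * θ * Complex.I))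
      = 2⁻¹ * (f (circleMap 0 r θ) * Complex.exp (-(k * θ * Complex.I))
        + (starRingEnd ℂ) (f (circleMap 0 r θ) * Complex.exp (k * θ * Complex.I))) := by
    intro θ
    rw [map_mul, ← Complex.exp_conj, Complex.real_smul, Complex.re_eq_add_conj]
    simp only [map_mul, Complex.conj_I, Complex.conj_ofReal, map_natCast, mul_neg]
    ring
  have i1 : IntervalIntegrable (fun θ : ℝ => f (circleMap 0 r θ)
      * Complex.exp (-(k * θ * Complex.I))) MeasureTheory.volume 0 (2 * Real.pi) :=
    (hc.mul (by fun_prop)).intervalIntegrable _ _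
  have i2 : IntervalIntegrable (fun θ : ℝ => (starRingEnd ℂ) (f (circleMap 0 r θ)
      * Complex.exp (k * θ * Complex.I))) MeasureTheory.volume 0 (2 * Real.pi) :=
    (Complex.continuous_conj.comp (hc.mul (by fun_prop))).intervalIntegrable _ _
  rw [intervalIntegral.integral_congr (fun θ _ => e θ), intervalIntegral.integral_const_mul,
    intervalIntegral.integral_add i1 i2, intervalIntegral.intervalIntegral_conj, h2, h1, map_zero]
  ring

/-- The `k`-th Fourier integral of the boundary value. -/
noncomputable def boundaryFourier (g : ℂ → ℝ) (R : ℝ) (k : ℤ) : ℂ :=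
  ∫ θ in (0 : ℝ)..(2 * Real.pi), g (circleMap 0 R θ) • Complex.exp (k * θ * Complex.I)

/-- Convergence in `L¹` allows passage to the limit in the integrals over inner circles. Negative
frequencies see the Taylor coefficients directly, and positive ones follow by conjugation because
`g` is real. -/
theorem HasL1BoundaryValue.norm_boundaryFourier (hbv : HasL1BoundaryValue u g R) (hR : 0 < R)
    (hf : DifferentiableOn ℂ f (Metric.ball 0 R)) (hu : ∀ z ∈ Metric.ball 0 R, (f z).re = u z)
    (hf0 : f 0 = 0) (k : ℤ) :
    ‖boundaryFourier g R k‖ = Real.pi * (R ^ k.natAbs * ‖taylorCoeff f k.natAbs‖) := by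
  have hucont : ContinuousOn u (Metric.ball 0 R) :=
    (Complex.continuous_re.comp_continuousOn hf.continuousOn).congr fun z hz => (hu z hz).symm
  have hneg : ∀ k : ℕ, boundaryFourier g R (-k) = Real.pi * R ^ k * taylorCoeff f k := by
    intro k
    have hK : Continuous fun θ : ℝ => Complex.exp (-(k * θ * Complex.I)) := by fun_prop
    have h1 := hbv.tendsto_integral_smul hR hucont hK
    have h2 : Tendsto (fun r : ℝ => (Real.pi : ℂ) * (r : ℂ) ^ k * taylorCoeff f k) (𝓝[<] R)
        (𝓝 (Real.pi * R ^ k * taylorCoeff f k)) := by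
      have : Continuous fun r : ℝ => (Real.pi : ℂ) * (r : ℂ) ^ k * taylorCoeff f k := by fun_prop
      exact (this.tendsto R).mono_left nhdsWithin_le_nhds
    have h3 := tendsto_nhds_unique h1 (h2.congr' ?_)
    · rw [← h3, boundaryFourier]
      refine intervalIntegral.integral_congr fun θ _ => ?_
      push_cast
      simp only [neg_mul]
    · filter_upwards [Ioo_mem_nhdsLT hR] with r hr
      rw [← integral_re_circleMap_mul_exp_neg hf hr.1 hr.2
        (Or.inr (by simp [taylorCoeff, hf0]))]
      refine intervalIntegral.integral_congr fun θ _ => ?_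
      simp only [hu _ (circleMap_zero_mem_ball hr.1.le hr.2)]
  have hnorm : ∀ k : ℕ, ‖boundaryFourier g R (-k)‖ = Real.pi * (R ^ k * ‖taylorCoeff f k‖) := by
    intro k
    rw [hneg, norm_mul, norm_mul, norm_pow, Complex.norm_real, Complex.norm_real,
      Real.norm_of_nonneg Real.pi_pos.le, Real.norm_of_nonneg hR.le, mul_assoc]
  have hconj : ∀ k : ℤ, ‖boundaryFourier g R k‖ = ‖boundaryFourier g R (-k)‖ := by
    intro k
    have e : boundaryFourier g R (-k) = (starRingEnd ℂ) (boundaryFourier g R k) := by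
      rw [boundaryFourier, boundaryFourier, ← intervalIntegral.intervalIntegral_conj]
      refine intervalIntegral.integral_congr fun θ _ => ?_
      simp only [Complex.real_smul, map_mul, ← Complex.exp_conj, Complex.conj_I,
        Complex.conj_ofReal, map_intCast]
      push_cast
      ring_nf
    rw [e, RCLike.norm_conj]
  obtain ⟨m, rfl | rfl⟩ := k.eq_nat_or_neg
  · rw [hconj, hnorm, Int.natAbs_natCast]
  · rw [hnorm, Int.natAbs_neg, Int.natAbs_natCast]

end FourierCoefficients

/-! ### The recurrence and the bound on the Taylor coefficients. -/

/-- Each factor `X - ζ` with unimodular `ζ` at most doubles the largest coefficient. -/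
theorem norm_coeff_prod_X_sub_C_le {ζ : ℕ → ℂ} (hζ : ∀ j, ‖ζ j‖ = 1) (N i : ℕ) :
    ‖(∏ j ∈ Finset.range N, (Polynomial.X - Polynomial.C (ζ j))).coeff i‖ ≤ 2 ^ N := by
  induction N generalizing i with
  | zero =>
    rw [Finset.prod_range_zero, Polynomial.coeff_one]
    split_ifs <;> simp
  | succ N ih =>
    rw [Finset.prod_range_succ, mul_sub, Polynomial.coeff_sub, Polynomial.coeff_mul_C]
    have h1 : ‖((∏ j ∈ Finset.range N, (Polynomial.X - Polynomial.C (ζ j)))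
        * Polynomial.X).coeff i‖ ≤ 2 ^ N := by
      cases i with
      | zero => simp
      | succ i => rw [Polynomial.coeff_mul_X]; exact ih i
    refine (norm_sub_le _ _).trans ?_
    rw [norm_mul, hζ, mul_one, pow_succ, mul_two]
    exact add_le_add h1 (ih i)

/-- A two-sided sequence that nearly satisfies a linear recurrence and vanishes near `0` grows at
most geometrically. -/
theorem le_geometric_of_recurrence {b : ℤ → ℂ} {B : ℕ → ℝ} {c : ℕ → ℂ} {n : ℕ} {A L κ : ℝ}
    (hκ : 0 < κ) (hb : ∀ k, ‖b k‖ = κ * B k.natAbs) (hB : ∀ j < n, B j = 0) (hL : 1 ≤ L)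
    (hc : ∀ l, ‖c l‖ ≤ L) (hc1 : c (2 * n) = 1)
    (hA : ∀ k : ℤ, ‖∑ l ∈ Finset.range (2 * n + 1), c l * b (k + l)‖ ≤ A)
    (hA' : A ≤ ‖∑ l ∈ Finset.range (2 * n + 1), c l * b (-n + l)‖) (N : ℕ) (hN : n ≤ N) :
    B N ≤ ((4 * n + 1) * L) ^ (N - n) * B n := by
  have hB0 : ∀ j, 0 ≤ B j := fun j => by
    have h := hb j
    rw [Int.natAbs_natCast] at h
    exact nonneg_of_mul_nonneg_right (h ▸ norm_nonneg _) hκ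
  set K : ℝ := (4 * n + 1) * L with hK
  have hK1 : 1 ≤ K := by
    have : (0 : ℝ) ≤ n := Nat.cast_nonneg n
    nlinarith
  have hsum : ∀ (M : ℕ) (k : ℤ) (D : ℝ), 0 ≤ D → (∀ l < M, B (k + l).natAbs ≤ D) →
      ‖∑ l ∈ Finset.range M, c l * b (k + l)‖ ≤ M * (L * (κ * D)) := by
    intro M k D hD h
    refine (norm_sum_le _ _).trans ?_
    calc ∑ l ∈ Finset.range M, ‖c l * b (k + l)‖ ≤ ∑ l ∈ Finset.range M, L * (κ * D) := by
          refine Finset.sum_le_sum fun l hl => ?_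
          rw [norm_mul, hb]
          have h1 := h l (Finset.mem_range.mp hl)
          have h2 := hB0 (k + l).natAbs
          exact mul_le_mul (hc l) (by gcongr) (by positivity) (by linarith)
      _ = M * (L * (κ * D)) := by simp
  -- The window from `-n` to `n` contains only zeros and the two end terms of size `B n`; each entry
  -- is crudely bounded by `B n`.
  have hAn : A ≤ (2 * n + 1) * (L * (κ * B n)) := by
    refine hA'.trans ((hsum (2 * n + 1) (-n) (B n) (hB0 n) fun l hl => ?_).trans_eq (by
      push_cast; ring))
    rcases Nat.lt_or_ge (-(n : ℤ) + l).natAbs n with h1 | h1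
    · rw [hB _ h1]
      exact hB0 n
    · rw [show (-(n : ℤ) + l).natAbs = n by omega]
  induction N using Nat.strong_induction_on with
  | _ N ih =>
    rcases hN.eq_or_lt with rfl | hlt
    · simp
    · obtain ⟨d, rfl⟩ : ∃ d, N = n + (d + 1) := ⟨N - n - 1, by omega⟩
      have hprev : ∀ j < n + (d + 1), B j ≤ K ^ d * B n := by
        intro j hj
        rcases Nat.lt_or_ge j n with h1 | h1
        · rw [hB j h1]
          exact mul_nonneg (by positivity) (hB0 n)
        · refine (ih j hj h1).trans ?_
          have : K ^ (j - n) ≤ K ^ d := pow_le_pow_right₀ hK1 (by omega)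
          exact mul_le_mul_of_nonneg_right this (hB0 n)
      have hD : 0 ≤ K ^ d * B n := mul_nonneg (by positivity) (hB0 n)
      -- The window is placed so that its last entry has index `n + d + 1`; all the others have
      -- smaller absolute index.
      set k : ℤ := (n + (d + 1) : ℕ) - (2 * n : ℕ) with hk
      have h1 := hA k
      have h2 := hsum (2 * n) k (K ^ d * B n) hD fun l hl => hprev _ (by omega)
      rw [Finset.sum_range_succ, hc1, one_mul] at h1
      have h3 : b (k + (2 * n : ℕ)) = b ((n + (d + 1) : ℕ)) := by
        congr 1
        omega
      have h4 := hb ((n + (d + 1) : ℕ))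
      rw [Int.natAbs_natCast] at h4
      have h5 : κ * B (n + (d + 1)) ≤ A + (2 * n : ℕ) * (L * (κ * (K ^ d * B n))) := by
        rw [← h4, ← h3]
        calc ‖b (k + (2 * n : ℕ))‖
            = ‖(∑ l ∈ Finset.range (2 * n), c l * b (k + l) + b (k + (2 * n : ℕ)))
              - ∑ l ∈ Finset.range (2 * n), c l * b (k + l)‖ := by rw [add_sub_cancel_left]
          _ ≤ _ := (norm_sub_le _ _).trans (add_le_add h1 h2)
      have hKd : 1 ≤ K ^ d := one_le_pow₀ hK1
      -- Source of the constant: `2n + 1` from the bound on `A` plus `2n` from the earlier terms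
      -- make `4n + 1`.
      have h6 : κ * B (n + (d + 1)) ≤ κ * (K ^ (d + 1) * B n) := by
        have e : κ * (K ^ (d + 1) * B n) = (2 * n + 1) * (L * (κ * (K ^ d * B n)))
            + (2 * n : ℕ) * (L * (κ * (K ^ d * B n))) := by
          rw [pow_succ, hK]
          push_cast
          ring
        rw [e]
        refine h5.trans (add_le_add_left (hAn.trans ?_) _)
        have h7 : B n ≤ K ^ d * B n := le_mul_of_one_le_left (hB0 n) hKd
        gcongr
      have h8 := le_of_mul_le_mul_left h6 hκ
      rwa [show n + (d + 1) - n = d + 1 by omega]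

/-- The Taylor coefficients of a holomorphic function whose real part has a nodal set composed of
`n` nodal curves through `0` are controlled by the `n`-th one. -/
theorem taylorCoeff_bounds {f : ℂ → ℂ} {u g : ℂ → ℝ} {R : ℝ} {n : ℕ}
    (hbv : HasL1BoundaryValue u g R) (hR : 0 < R)
    (hharm : InnerProductSpace.HarmonicOnNhd u (Metric.ball 0 R))
    (hf : AnalyticOnNhd ℂ f (Metric.ball 0 R)) (hu : ∀ z ∈ Metric.ball 0 R, (f z).re = u z)
    (hf0 : f 0 = 0) (hnc : ¬ ∃ a, ∀ z ∈ Metric.ball (0 : ℂ) R, f z = a)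
    (h : HasOnlyNodalCurvesThrough u (Metric.ball 0 R) 0 n) :
    (∀ k < n, taylorCoeff f k = 0) ∧ ∀ N ≥ n, R ^ N * ‖taylorCoeff f N‖
      ≤ ((4 * n + 1) * 4 ^ n) ^ (N - n) * (R ^ n * ‖taylorCoeff f n‖) := by
  have h0mem : (0 : ℂ) ∈ Metric.ball (0 : ℂ) R := Metric.mem_ball_self hR
  have hzero : ∀ k < n, taylorCoeff f k = 0 := by
    intro k hk
    have h1 := le_analyticOrderAt_of_hasOnlyNodalCurvesThrough hf hu h0mem hf0
      (not_eventually_eq_of_not_const hf hnc h0mem) h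
    rw [natCast_le_analyticOrderAt_iff_iteratedDeriv_eq_zero (hf 0 h0mem)] at h1
    rw [taylorCoeff, h1 k hk, zero_div]
  refine ⟨hzero, fun N hN => ?_⟩
  obtain ⟨ζ, C, hζ, hC, hae⟩ := hbv.exists_unit_roots hR hharm hf hu hnc h
  set p : Polynomial ℂ := ∏ j ∈ Finset.range (2 * n), (Polynomial.X - Polynomial.C (ζ j)) with hp
  have hpeval : ∀ z : ℂ, p.eval z = ∏ j ∈ Finset.range (2 * n), (z - ζ j) := by
    intro z
    rw [hp, Polynomial.eval_prod]
    simp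
  have hpmonic : p.Monic := Polynomial.monic_prod_of_monic _ _ fun j _ => Polynomial.monic_X_sub_C _
  have hpdeg : p.natDegree = 2 * n := by
    rw [hp, Polynomial.natDegree_prod_of_monic _ _ fun j _ => Polynomial.monic_X_sub_C _]
    simp
  have hg : IntervalIntegrable (fun θ => g (circleMap 0 R θ)) MeasureTheory.volume 0
    (2 * Real.pi) := hbv.1
  set F : ℤ → ℝ → ℂ := fun k t => g (circleMap 0 R t) •
    (Complex.exp (k * t * Complex.I) * p.eval (Complex.exp (t * Complex.I))) with hF
  have hpc : Continuous fun t : ℝ => p.eval (Complex.exp (t * Complex.I)) :=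
    p.continuous.comp (by fun_prop)
  have hsum : ∀ k : ℤ, ∑ l ∈ Finset.range (2 * n + 1), p.coeff l * boundaryFourier g R (k + l)
      = ∫ t in (0 : ℝ)..(2 * Real.pi), F k t := by
    intro k
    simp only [boundaryFourier, ← intervalIntegral.integral_const_mul]
    rw [← intervalIntegral.integral_finsetSum]
    · refine intervalIntegral.integral_congr fun t _ => ?_
      simp only [hF]
      rw [Polynomial.eval_eq_sum_range, hpdeg, Finset.mul_sum, Finset.smul_sum]
      refine Finset.sum_congr rfl fun l _ => ?_
      rw [Complex.real_smul, Complex.real_smul, ← Complex.exp_nat_mul]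
      have : Complex.exp (((k + l : ℤ) : ℂ) * t * Complex.I)
          = Complex.exp (k * t * Complex.I) * Complex.exp (l * (t * Complex.I)) := by
        rw [← Complex.exp_add]
        push_cast
        ring_nf
      rw [this]
      ring
    · intro l _
      exact (hg.smul_continuousOn (by fun_prop)).const_mul _
  set A : ℝ := ∫ t in (0 : ℝ)..(2 * Real.pi),
    ‖(g (circleMap 0 R t) : ℂ) * p.eval (Complex.exp (t * Complex.I))‖ with hAdef
  have hnormF : ∀ k t, ‖F k t‖
      = ‖(g (circleMap 0 R t) : ℂ) * p.eval (Complex.exp (t * Complex.I))‖ := by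
    intro k t
    have e1 : ‖Complex.exp (k * t * Complex.I)‖ = 1 := by
      have := Complex.norm_exp_ofReal_mul_I (k * t)
      rwa [Complex.ofReal_mul, Complex.ofReal_intCast] at this
    simp only [hF, Complex.real_smul, norm_mul, e1, one_mul]
  have hA : ∀ k : ℤ, ‖∑ l ∈ Finset.range (2 * n + 1), p.coeff l * boundaryFourier g R (k + l)‖
      ≤ A := by
    intro k
    rw [hsum]
    refine (intervalIntegral.norm_integral_le_integral_norm (by positivity)).trans_eq ?_
    exact intervalIntegral.integral_congr fun t _ => hnormF k t
  have hA' : A ≤ ‖∑ l ∈ Finset.range (2 * n + 1),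
      p.coeff l * boundaryFourier g R (-n + l)‖ := by
    -- The shift by `-n` turns `p` into the trigonometric polynomial for which the integrand is `C`
    -- times its modulus, so no cancellation occurs and the integral is `C * A`.
    have e : ∫ t in (0 : ℝ)..(2 * Real.pi), F (-n) t = C * A := by
      rw [hAdef, ← intervalIntegral.integral_ofReal, ← intervalIntegral.integral_const_mul]
      refine intervalIntegral.integral_congr_ae ?_
      have hne : ∀ᵐ t : ℝ, t ≠ 2 * Real.pi := by
        simp [MeasureTheory.ae_iff, MeasureTheory.measure_singleton]
      filter_upwards [hae, hne] with t ht ht2 htI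
      rw [uIoc_of_le (by positivity)] at htI
      have h1 := ht ⟨htI.1, lt_of_le_of_ne htI.2 ht2⟩
      rw [← hpeval] at h1
      rw [← h1]
      simp only [hF, Complex.real_smul]
      push_cast
      ring_nf
    have hA0 : 0 ≤ A := intervalIntegral.integral_nonneg (by positivity) fun t _ => norm_nonneg _
    rw [hsum, e, norm_mul, hC, one_mul, Complex.norm_real, Real.norm_of_nonneg hA0]
  have hL : (1 : ℝ) ≤ 4 ^ n := one_le_pow₀ (by norm_num)
  refine le_geometric_of_recurrence (b := boundaryFourier g R) (c := p.coeff) (n := n) (A := A)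
    (L := 4 ^ n) (κ := Real.pi) (B := fun N => R ^ N * ‖taylorCoeff f N‖) Real.pi_pos
    (hbv.norm_boundaryFourier hR hf.differentiableOn hu hf0)
    (fun j hj => by simp [hzero j hj]) hL (fun l => ?_) ?_ hA hA' N hN
  · have := norm_coeff_prod_X_sub_C_le hζ (2 * n) l
    rwa [pow_mul, show (2 : ℝ) ^ 2 = 4 by norm_num] at this
  · rw [← hpdeg]
    exact hpmonic.coeff_natDegree

/-! ### Curvature of level curves in terms of complex derivatives. -/

theorem fderiv_re_apply {G : ℂ → ℂ} {φ : ℂ → ℝ} {z : ℂ} (hG : DifferentiableAt ℂ G z)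
    (he : φ =ᶠ[𝓝 z] fun w => (G w).re) (v : ℂ) : fderiv ℝ φ z v = (deriv G z * v).re := by
  have h : HasFDerivAt (fun w => (G w).re) _ z :=
    Complex.reCLM.hasFDerivAt.comp z (hG.hasDerivAt.hasFDerivAt.restrictScalars ℝ)
  rw [he.fderiv_eq, h.fderiv]
  simp [mul_comm]

section LevelCurves

variable {f : ℂ → ℂ} {u : ℂ → ℝ} {Ω : Set ℂ} {z : ℂ}

theorem partialX_eq (hΩ : IsOpen Ω) (hf : AnalyticOnNhd ℂ f Ω) (hu : ∀ z ∈ Ω, (f z).re = u z)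
    (hz : z ∈ Ω) : partialX u z = (deriv f z).re := by
  have he : u =ᶠ[𝓝 z] fun w => (f w).re := by
    filter_upwards [hΩ.mem_nhds hz] with w hw using (hu w hw).symm
  rw [partialX, fderiv_re_apply (hf z hz).differentiableAt he, mul_one]

theorem partialY_eq (hΩ : IsOpen Ω) (hf : AnalyticOnNhd ℂ f Ω) (hu : ∀ z ∈ Ω, (f z).re = u z)
    (hz : z ∈ Ω) : partialY u z = (deriv f z * Complex.I).re := by
  have he : u =ᶠ[𝓝 z] fun w => (f w).re := by
    filter_upwards [hΩ.mem_nhds hz] with w hw using (hu w hw).symm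
  rw [partialY, fderiv_re_apply (hf z hz).differentiableAt he]

/-- The curvature of the level curves of `Re f` in terms of the derivatives of `f`. -/
theorem nodalCurvature_eq (hΩ : IsOpen Ω) (hf : AnalyticOnNhd ℂ f Ω)
    (hu : ∀ z ∈ Ω, (f z).re = u z) (hz : z ∈ Ω) :
    nodalCurvature u z
      = (deriv (deriv f) z * (starRingEnd ℂ) (deriv f z) ^ 2).re / ‖deriv f z‖ ^ 3 := by
  have hX : partialX u =ᶠ[𝓝 z] fun w => (deriv f w).re := by
    filter_upwards [hΩ.mem_nhds hz] with w hw using partialX_eq hΩ hf hu hw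
  have hY : partialY u =ᶠ[𝓝 z] fun w => (deriv f w * Complex.I).re := by
    filter_upwards [hΩ.mem_nhds hz] with w hw using partialY_eq hΩ hf hu hw
  have hd := (hf.deriv z hz).differentiableAt
  have hXX : partialX (partialX u) z = (deriv (deriv f) z * 1).re := fderiv_re_apply hd hX 1
  have hYX : partialY (partialX u) z = (deriv (deriv f) z * Complex.I).re :=
    fderiv_re_apply hd hX Complex.I
  have hYY : partialY (partialY u) z = (deriv (deriv f) z * Complex.I * Complex.I).re := by
    rw [partialY, fderiv_re_apply (hd.mul_const _) hY, deriv_mul_const hd]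
  rw [nodalCurvature, hXX, hYX, hYY, partialX_eq hΩ hf hu hz, partialY_eq hΩ hf hu hz]
  have hn : Real.sqrt ((deriv f z).re ^ 2 + (deriv f z * Complex.I).re ^ 2) = ‖deriv f z‖ := by
    rw [Complex.norm_def, Complex.normSq_apply]
    congr 1
    simp
    ring
  rw [hn]
  congr 1
  simp [pow_two]
  ring

/-- The curvature of a nodal arc is, up to sign, the curvature of the level curve. -/
theorem IsNodalArc.abs_curveCurvature_eq (hΩ : IsOpen Ω) (hf : AnalyticOnNhd ℂ f Ω)
    (hu : ∀ z ∈ Ω, (f z).re = u z) {I : Set ℝ} {γ : ℝ → ℂ} (h : IsNodalArc u Ω I γ) {t : ℝ}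
    (ht : t ∈ I) (hne : deriv f (γ t) ≠ 0) :
    |curveCurvature γ t| = |nodalCurvature u (γ t)| := by
  have hz := (h.mapsTo ht).1
  rw [nodalCurvature_eq hΩ hf hu hz]
  set z := γ t with hzdef
  set v := deriv γ t with hv
  set a := deriv (deriv γ) t with ha
  set d := deriv f z with hd
  set e := deriv (deriv f) z with he
  have hv1 : ‖v‖ = 1 := h.unit_speed t ht
  have hda : HasDerivAt (deriv γ) a t := (h.analytic t ht).deriv.differentiableAt.hasDerivAt
  have hvn : v.re ^ 2 + v.im ^ 2 = 1 := by
    have := Complex.normSq_eq_norm_sq v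
    rw [hv1, Complex.normSq_apply] at this
    linarith
  have hva : v.re * a.re + v.im * a.im = 0 := by
    have h1 : HasDerivAt (fun s => (deriv γ s).re * (deriv γ s).re
        + (deriv γ s).im * (deriv γ s).im)
        (a.re * v.re + v.re * a.re + (a.im * v.im + v.im * a.im)) t := by
      have hre : HasDerivAt (fun s => (deriv γ s).re) a.re t :=
        Complex.reCLM.hasFDerivAt.comp_hasDerivAt t hda
      have him : HasDerivAt (fun s => (deriv γ s).im) a.im t :=
        Complex.imCLM.hasFDerivAt.comp_hasDerivAt t hda
      exact (hre.mul hre).add (him.mul him)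
    have h2 : (fun s => (deriv γ s).re * (deriv γ s).re + (deriv γ s).im * (deriv γ s).im)
        =ᶠ[𝓝 t] fun _ => 1 := by
      filter_upwards [h.eventually_mem ht] with s hs
      have := Complex.normSq_eq_norm_sq (deriv γ s)
      rw [h.unit_speed s hs, Complex.normSq_apply] at this
      linarith
    have h3 := (h1.congr_of_eventuallyEq h2.symm).unique (hasDerivAt_const t (1 : ℝ))
    linarith
  have hdv : (d * v).re = 0 := h.re_deriv_mul_deriv hf hu ht
  -- Second derivative of `Re f` along the arc, where it is identically zero.
  have hsecond : (e * v * v + d * a).re = 0 := by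
    have h1 : HasDerivAt (fun s => deriv f (γ s) * deriv γ s) (e * v * v + d * a) t :=
      (hasDerivAt_comp_real (hf.deriv z hz).differentiableAt
        (h.analytic t ht).differentiableAt).mul hda
    have h2 : HasDerivAt (fun s => (deriv f (γ s) * deriv γ s).re) (e * v * v + d * a).re t :=
      Complex.reCLM.hasFDerivAt.comp_hasDerivAt t h1
    have h3 : (fun s => (deriv f (γ s) * deriv γ s).re) =ᶠ[𝓝 t] fun _ => 0 := by
      filter_upwards [h.eventually_mem ht] with s hs using h.re_deriv_mul_deriv hf hu hs
    exact (h2.congr_of_eventuallyEq h3.symm).unique (hasDerivAt_const t 0)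
  set k := v.re * a.im - v.im * a.re with hk
  have hcurv : curveCurvature γ t = k := by
    rw [curveCurvature, ← hv, ← ha, hv1]
    simp [hk]
  -- At unit speed the acceleration is normal to the velocity, with the curvature as its length up
  -- to sign.
  have hak : a = k * Complex.I * v := by
    apply Complex.ext <;> simp [hk]
    · linear_combination -a.re * hvn + v.re * hva
    · linear_combination -a.im * hvn + v.im * hva
  set s := (d * v).im with hs
  have hdvs : d * v = s * Complex.I := by
    apply Complex.ext <;> simp [hdv, hs]
  have hsn : |s| = ‖d‖ := by
    have : ‖d * v‖ = ‖d‖ := by rw [norm_mul, hv1, mul_one]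
    rw [← this, hs, Complex.abs_im_eq_norm.mpr hdv]
  have hks : (e * v * v).re = k * s := by
    have h1 : d * a = ((-(k * s) : ℝ) : ℂ) := by
      rw [hak]
      push_cast
      linear_combination k * Complex.I * hdvs + k * s * Complex.I_sq
    rw [Complex.add_re, h1, Complex.ofReal_re] at hsecond
    linarith
  have hdd : (starRingEnd ℂ) d * d = ((‖d‖ ^ 2 : ℝ) : ℂ) := by
    rw [mul_comm, Complex.mul_conj, Complex.normSq_eq_norm_sq]
  have hs2 : s ^ 2 = ‖d‖ ^ 2 := by rw [← hsn, sq_abs]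
  have hnum : (e * (starRingEnd ℂ) d ^ 2).re * s ^ 2 = -(‖d‖ ^ 4 * (k * s)) := by
    have h1 : e * (starRingEnd ℂ) d ^ 2 * ((s ^ 2 : ℝ) : ℂ)
        = ((-(‖d‖ ^ 4) : ℝ) : ℂ) * (e * v * v) := by
      have h2 : ((s ^ 2 : ℝ) : ℂ) = -(d * v) ^ 2 := by
        rw [hdvs, mul_pow, Complex.I_sq]
        push_cast
        ring
      have h3 : (((‖d‖ ^ 4) : ℝ) : ℂ) = ((starRingEnd ℂ) d * d) ^ 2 := by
        rw [hdd]
        push_cast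
        ring
      rw [h2, Complex.ofReal_neg, h3]
      ring
    have h4 := congrArg Complex.re h1
    rw [Complex.re_mul_ofReal, Complex.re_ofReal_mul, hks] at h4
    linarith
  have hd0 : 0 < ‖d‖ := norm_pos_iff.mpr hne
  have hnum2 : (e * (starRingEnd ℂ) d ^ 2).re = -(‖d‖ ^ 2 * (k * s)) := by
    rw [hs2] at hnum
    have : ‖d‖ ^ 2 * (e * (starRingEnd ℂ) d ^ 2).re = ‖d‖ ^ 2 * (-(‖d‖ ^ 2 * (k * s))) := by
      linear_combination hnum
    exact mul_left_cancel₀ (by positivity) this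
  rw [hcurv, hnum2, abs_div, abs_neg, abs_mul, abs_mul, hsn, abs_of_pos (pow_pos hd0 2),
    abs_of_pos (pow_pos hd0 3)]
  field_simp

end LevelCurves

/-! ### Comparison with a monomial and the curvature estimate. -/

/-- The pointwise estimate behind the curvature bound: `w`, `d₁`, `d₂` are close to the value and
the first two derivatives at `z` of a monomial of degree `n`, and `w` is purely imaginary. -/
theorem abs_re_mul_conj_sq_le {n : ℕ} (hn : 1 ≤ n) {w d₁ d₂ z : ℂ} {l : ℝ} (hw : w.re = 0)
    (hw0 : w ≠ 0) (hz : z ≠ 0) (hl0 : 0 ≤ l) (hl : l ≤ 1 / 16)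
    (h₁ : ‖z * d₁ - n * w‖ ≤ 8 * l * ‖w‖)
    (h₂ : ‖z ^ 2 * d₂ - n * (n - 1) * w‖ ≤ (16 * n + 4) * l * ‖w‖) :
    d₁ ≠ 0 ∧ |(d₂ * (starRingEnd ℂ) d₁ ^ 2).re| / ‖d₁‖ ^ 3
      ≤ 8 * ((16 * n + 4) * (n + 1) ^ 2 + 8 * n ^ 2 * (2 * n + 1)) * (l / ‖z‖) := by
  have hW : 0 < ‖w‖ := norm_pos_iff.mpr hw0
  have hZ : 0 < ‖z‖ := norm_pos_iff.mpr hz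
  have hn1 : (1 : ℝ) ≤ n := by exact_mod_cast hn
  set e₁ := z * d₁ - n * w with he₁
  set e₂ := z ^ 2 * d₂ - n * (n - 1) * w with he₂
  have hnw : ‖(n : ℂ) * w‖ = n * ‖w‖ := by rw [norm_mul, Complex.norm_natCast]
  have h₁' : ‖e₁‖ ≤ ‖w‖ := h₁.trans (by nlinarith)
  have hzd : z * d₁ = n * w + e₁ := by rw [he₁]; ring
  have hzd2 : z ^ 2 * d₂ = n * (n - 1) * w + e₂ := by rw [he₂]; ring
  have hlow : ‖w‖ / 2 ≤ ‖z‖ * ‖d₁‖ := by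
    rw [← norm_mul, hzd]
    have h3 := norm_sub_le (n * w + e₁) e₁
    rw [add_sub_cancel_right, hnw] at h3
    have : ‖e₁‖ ≤ ‖w‖ / 2 := h₁.trans (by nlinarith)
    nlinarith
  have hd₁ : d₁ ≠ 0 := by
    rintro rfl
    rw [norm_zero, mul_zero] at hlow
    linarith
  refine ⟨hd₁, ?_⟩
  have hD : 0 < ‖d₁‖ := norm_pos_iff.mpr hd₁
  have hup : ‖n * w + e₁‖ ≤ (n + 1) * ‖w‖ := by
    refine (norm_add_le _ _).trans ?_
    rw [hnw]
    linarith
  -- The value of the numerator for an exact monomial, up to the factor `‖z‖ ^ 4`. It is a real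
  -- multiple of the conjugate of `w`, so its real part vanishes, and this cancellation gains the
  -- factor `l`.
  set M : ℂ := (n : ℂ) * (n - 1) * w * (starRingEnd ℂ) (n * w) ^ 2 with hM
  have hMre : M.re = 0 := by
    have e : M = ((n * (n - 1) * n ^ 2 * ‖w‖ ^ 2 : ℝ) : ℂ) * (starRingEnd ℂ) w := by
      have h3 : (w : ℂ) * (starRingEnd ℂ) w = ((‖w‖ ^ 2 : ℝ) : ℂ) := by
        rw [Complex.mul_conj, Complex.normSq_eq_norm_sq]
      rw [hM, map_mul, map_natCast]
      push_cast at h3 ⊢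
      linear_combination (n : ℂ) ^ 3 * (n - 1) * (starRingEnd ℂ) w * h3
    rw [e, Complex.re_ofReal_mul, Complex.conj_re, hw, mul_zero]
  have hprod : ((‖z‖ ^ 4 : ℝ) : ℂ) * (d₂ * (starRingEnd ℂ) d₁ ^ 2)
      = (n * (n - 1) * w + e₂) * (starRingEnd ℂ) (n * w + e₁) ^ 2 := by
    have h3 : z * (starRingEnd ℂ) z = ((‖z‖ ^ 2 : ℝ) : ℂ) := by
      rw [Complex.mul_conj, Complex.normSq_eq_norm_sq]
    rw [← hzd, ← hzd2, map_mul]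
    have h4 : ((‖z‖ ^ 4 : ℝ) : ℂ) = (z * (starRingEnd ℂ) z) ^ 2 := by
      rw [h3]; push_cast; ring
    rw [h4]
    ring
  have hdiff : (n * (n - 1) * w + e₂) * (starRingEnd ℂ) (n * w + e₁) ^ 2 - M
      = e₂ * (starRingEnd ℂ) (n * w + e₁) ^ 2
        + n * (n - 1) * w * ((starRingEnd ℂ) e₁ * (starRingEnd ℂ) (2 * (n * w) + e₁)) := by
    rw [hM]
    simp only [map_add, map_mul, map_natCast, map_ofNat]
    ring
  have hbound : ‖z‖ ^ 4 * |(d₂ * (starRingEnd ℂ) d₁ ^ 2).re|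
      ≤ ((16 * n + 4) * (n + 1) ^ 2 + 8 * n ^ 2 * (2 * n + 1)) * l * ‖w‖ ^ 3 := by
    have e : ‖z‖ ^ 4 * |(d₂ * (starRingEnd ℂ) d₁ ^ 2).re|
        = |((n * (n - 1) * w + e₂) * (starRingEnd ℂ) (n * w + e₁) ^ 2 - M).re| := by
      rw [Complex.sub_re, hMre, sub_zero, ← hprod, Complex.re_ofReal_mul, abs_mul,
        abs_of_pos (pow_pos hZ 4)]
    rw [e, hdiff]
    refine (Complex.abs_re_le_norm _).trans ((norm_add_le _ _).trans ?_)
    have t1 : ‖e₂ * (starRingEnd ℂ) (n * w + e₁) ^ 2‖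
        ≤ ((16 * n + 4) * l * ‖w‖) * ((n + 1) * ‖w‖) ^ 2 := by
      rw [norm_mul, norm_pow, RCLike.norm_conj]
      gcongr
    have hnn : ‖(n : ℂ) * (n - 1)‖ ≤ n ^ 2 := by
      have : (n : ℂ) * (n - 1) = ((n * (n - 1) : ℝ) : ℂ) := by push_cast; ring
      rw [this, Complex.norm_real, Real.norm_of_nonneg (by nlinarith)]
      nlinarith
    have t2 : ‖(n : ℂ) * (n - 1) * w * ((starRingEnd ℂ) e₁ * (starRingEnd ℂ) (2 * (n * w) + e₁))‖
        ≤ n ^ 2 * ‖w‖ * ((8 * l * ‖w‖) * ((2 * n + 1) * ‖w‖)) := by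
      have h5 : ‖2 * (n * w) + e₁‖ ≤ (2 * n + 1) * ‖w‖ := by
        refine (norm_add_le _ _).trans ?_
        rw [norm_mul, hnw, Complex.norm_ofNat]
        linarith
      rw [norm_mul, norm_mul _ w, norm_mul ((starRingEnd ℂ) e₁), RCLike.norm_conj, RCLike.norm_conj]
      gcongr
    refine (add_le_add t1 t2).trans_eq ?_
    ring
  have hcube : ‖w‖ ^ 3 ≤ 8 * (‖z‖ ^ 3 * ‖d₁‖ ^ 3) := by
    have := pow_le_pow_left₀ (by positivity) hlow 3
    rw [mul_pow, div_pow] at this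
    linarith
  set C₀ : ℝ := (16 * n + 4) * (n + 1) ^ 2 + 8 * n ^ 2 * (2 * n + 1) with hC₀
  have hC₀0 : 0 ≤ C₀ := by positivity
  rw [div_le_iff₀ (pow_pos hD 3)]
  have h6 : ‖z‖ ^ 4 * |(d₂ * (starRingEnd ℂ) d₁ ^ 2).re|
      ≤ ‖z‖ ^ 4 * (8 * C₀ * (l / ‖z‖) * ‖d₁‖ ^ 3) := by
    calc _ ≤ C₀ * l * ‖w‖ ^ 3 := hbound
      _ ≤ C₀ * l * (8 * (‖z‖ ^ 3 * ‖d₁‖ ^ 3)) := by gcongr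
      _ = _ := by field_simp
  exact le_of_mul_le_mul_left h6 (pow_pos hZ 4)

/-- Geometric control of the Taylor coefficients by the `n`-th one yields a factorization `z ^ n * h`
with bounded `h`. -/
theorem exists_eq_pow_mul_of_taylorCoeff_le {f : ℂ → ℂ} {R K : ℝ} {n : ℕ} (hR : 0 < R) (hK : 1 ≤ K)
    (hf : DifferentiableOn ℂ f (Metric.ball 0 R)) (h0 : ∀ k < n, taylorCoeff f k = 0)
    (hb : ∀ N ≥ n, R ^ N * ‖taylorCoeff f N‖ ≤ K ^ (N - n) * (R ^ n * ‖taylorCoeff f n‖)) :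
    ∃ h : ℂ → ℂ, DifferentiableOn ℂ h (Metric.ball 0 (R / (2 * K))) ∧ h 0 = taylorCoeff f n ∧
      ∀ z ∈ Metric.ball (0 : ℂ) (R / (2 * K)),
        f z = z ^ n * h z ∧ ‖h z‖ ≤ 2 * ‖taylorCoeff f n‖ := by
  set A := ‖taylorCoeff f n‖ with hA
  have hK0 : 0 < K := by linarith
  have hcoef : ∀ j, ‖taylorCoeff f (j + n)‖ ≤ (K / R) ^ j * A := by
    intro j
    have h1 := hb (j + n) (by omega)
    rw [Nat.add_sub_cancel, pow_add] at h1
    have h2 : R ^ n * (R ^ j * ‖taylorCoeff f (j + n)‖) ≤ R ^ n * (K ^ j * A) := by linarith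
    have h3 := le_of_mul_le_mul_left h2 (by positivity)
    rw [div_pow, div_mul_eq_mul_div, le_div_iff₀ (by positivity)]
    linarith
  -- The radius `R / (2 * K)` is half the radius `R / K` given by the coefficient bounds, whence the
  -- ratio `1 / 2`.
  have hterm : ∀ (j : ℕ) (z : ℂ), z ∈ Metric.ball (0 : ℂ) (R / (2 * K)) →
      ‖taylorCoeff f (j + n) * z ^ j‖ ≤ A * (1 / 2) ^ j := by
    intro j z hz
    have hz' : ‖z‖ ≤ R / (2 * K) := le_of_lt (by simpa using hz)
    rw [norm_mul, norm_pow]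
    calc ‖taylorCoeff f (j + n)‖ * ‖z‖ ^ j ≤ (K / R) ^ j * A * (R / (2 * K)) ^ j := by
          gcongr
          exact hcoef j
      _ = A * (K / R * (R / (2 * K))) ^ j := by rw [mul_pow]; ring
      _ = A * (1 / 2) ^ j := by
          congr 2
          field_simp
  have hgeom : HasSum (fun j : ℕ => A * (1 / 2 : ℝ) ^ j) (2 * A) := by
    have := (hasSum_geometric_two).mul_left A
    rwa [mul_comm A 2] at this
  have hsub : Metric.ball (0 : ℂ) (R / (2 * K)) ⊆ Metric.ball 0 R := by
    refine Metric.ball_subset_ball ?_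
    rw [div_le_iff₀ (by positivity)]
    nlinarith
  refine ⟨fun z => ∑' j, taylorCoeff f (j + n) * z ^ j, ?_, ?_, fun z hz => ⟨?_, ?_⟩⟩
  · exact Complex.differentiableOn_tsum_of_summable_norm hgeom.summable
      (fun j => (differentiableOn_id.pow j).const_mul _) Metric.isOpen_ball hterm
  · simp only
    rw [tsum_eq_single 0 fun j hj => by simp [hj]]
    simp
  · have hs : Summable fun j => taylorCoeff f (j + n) * z ^ j :=
      hgeom.summable.of_norm_bounded fun j => hterm j z hz
    have h1 : HasSum (fun k => taylorCoeff f k * z ^ k) (f z) := by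
      refine (Complex.hasSum_taylorSeries_on_ball hf (hsub hz)).congr_fun fun k => ?_
      rw [taylorCoeff, sub_zero, smul_eq_mul, smul_eq_mul]
      ring
    have h2 := (hasSum_nat_add_iff' n).mpr h1
    rw [Finset.sum_eq_zero fun k hk => by rw [h0 k (Finset.mem_range.mp hk), zero_mul],
      sub_zero] at h2
    refine h2.unique ((hs.hasSum.mul_left (z ^ n)).congr_fun fun j => ?_)
    rw [pow_add]
    ring
  · exact tsum_of_norm_bounded hgeom fun j => hterm j z hz

/-- The value and the first two derivatives of `z ^ n * h` near `0`, compared with those of a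
monomial. -/
theorem pow_mul_derivative_bounds {f h : ℂ → ℂ} {ρ A : ℝ} {n : ℕ} (hn : 1 ≤ n) (hρ : 0 < ρ)
    (hA : 0 < A) (hh : DifferentiableOn ℂ h (Metric.ball 0 ρ)) (hh0 : ‖h 0‖ = A)
    (hfh : ∀ z ∈ Metric.ball (0 : ℂ) ρ, f z = z ^ n * h z ∧ ‖h z‖ ≤ 2 * A) {z : ℂ} (hz0 : z ≠ 0)
    (hz : ‖z‖ / ρ ≤ 1 / 16) :
    f z ≠ 0 ∧ ‖z * deriv f z - n * f z‖ ≤ 8 * (‖z‖ / ρ) * ‖f z‖ ∧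
      ‖z ^ 2 * deriv (deriv f) z - n * (n - 1) * f z‖
        ≤ (16 * n + 4) * (‖z‖ / ρ) * ‖f z‖ := by
  have hZ : 0 < ‖z‖ := norm_pos_iff.mpr hz0
  set l := ‖z‖ / ρ with hl
  have hl0 : 0 < l := div_pos hZ hρ
  have hzl : ‖z‖ = l * ρ := by rw [hl]; field_simp
  -- Since `l ≤ 1/16`, discs of radius `ρ / 2` about such points stay in the domain, so Cauchy's
  -- estimates with `‖h‖ ≤ 2A` give `4A/ρ` and `16A/ρ²`.
  have hcl : ∀ w : ℂ, ‖w‖ ≤ l * ρ → Metric.closedBall w (ρ / 2) ⊆ Metric.ball 0 ρ := by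
    intro w hw x hx
    rw [mem_ball_zero_iff]
    rw [mem_closedBall_iff_norm] at hx
    have := norm_sub_norm_le x w
    nlinarith
  have hdc : ∀ w : ℂ, ‖w‖ ≤ l * ρ → DiffContOnCl ℂ h (Metric.ball w (ρ / 2)) := fun w hw =>
    (hh.mono ((closure_ball w (half_pos hρ).ne').symm ▸ hcl w hw)).diffContOnCl
  have hd1 : ∀ w : ℂ, ‖w‖ ≤ l * ρ → ‖deriv h w‖ ≤ 4 * A / ρ := by
    intro w hw
    have := Complex.norm_deriv_le_of_forall_mem_sphere_norm_le (half_pos hρ) (hdc w hw)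
      fun x hx => (hfh x (hcl w hw (Metric.sphere_subset_closedBall hx))).2
    refine this.trans_eq ?_
    field_simp
    ring
  have hd2 : ‖deriv (deriv h) z‖ ≤ 16 * A / ρ ^ 2 := by
    have := Complex.norm_iteratedDeriv_le_of_forall_mem_sphere_norm_le 2 (half_pos hρ)
      (hdc z hzl.le) fun x hx => (hfh x (hcl z hzl.le (Metric.sphere_subset_closedBall hx))).2
    rw [iteratedDeriv_succ, iteratedDeriv_one] at this
    refine this.trans_eq ?_
    norm_num
    field_simp
    ring
  have hzball : z ∈ Metric.ball (0 : ℂ) ρ := hcl z hzl.le (Metric.mem_closedBall_self (by positivity))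
  have hlow : A / 2 ≤ ‖h z‖ := by
    have h1 : ‖h z - h 0‖ ≤ 4 * A / ρ * ‖z - 0‖ := by
      refine (convex_closedBall (0 : ℂ) (l * ρ)).norm_image_sub_le_of_norm_deriv_le (𝕜 := ℂ)
        (fun w hw => ?_) (fun w hw => hd1 w (by simpa using hw)) (by simp; positivity)
        (by simp [hzl])
      exact hh.differentiableAt (Metric.isOpen_ball.mem_nhds (hcl w (by simpa using hw)
        (Metric.mem_closedBall_self (by positivity))))
    have h2 : 4 * A / ρ * ‖z - 0‖ = 4 * A * l := by
      rw [sub_zero, hzl]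
      field_simp
    have h3 := norm_sub_norm_le (h 0) (h z)
    rw [norm_sub_rev, hh0] at h3
    nlinarith
  have hw : ‖f z‖ = ‖z‖ ^ n * ‖h z‖ := by rw [(hfh z hzball).1, norm_mul, norm_pow]
  have hwlow : ‖z‖ ^ n * A ≤ 2 * ‖f z‖ := by
    rw [hw]
    have : 0 < ‖z‖ ^ n := by positivity
    nlinarith
  -- Covers the truncated exponent `k - 1` at `k = 0`, needed for the second derivative when `n =
  -- 1`.
  have aux : ∀ (k : ℕ) (x : ℂ), (k : ℂ) * x ^ (k - 1) * x = k * x ^ k := by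
    intro k x
    cases k with
    | zero => simp
    | succ k => rw [Nat.add_sub_cancel, pow_succ]; ring
  have hderiv : ∀ x ∈ Metric.ball (0 : ℂ) ρ,
      HasDerivAt f (n * x ^ (n - 1) * h x + x ^ n * deriv h x) x := by
    intro x hx
    have h1 := (hasDerivAt_pow n x).mul
      (hh.differentiableAt (Metric.isOpen_ball.mem_nhds hx)).hasDerivAt
    refine h1.congr_of_eventuallyEq ?_
    filter_upwards [Metric.isOpen_ball.mem_nhds hx] with y hy using (hfh y hy).1
  have hderiv2 : HasDerivAt (deriv f) (n * ((n - 1 : ℕ) * z ^ (n - 1 - 1)) * h z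
      + n * z ^ (n - 1) * deriv h z + (n * z ^ (n - 1) * deriv h z + z ^ n * deriv (deriv h) z))
      z := by
    have hhd : HasDerivAt h (deriv h z) z :=
      (hh.differentiableAt (Metric.isOpen_ball.mem_nhds hzball)).hasDerivAt
    have hhdd : HasDerivAt (deriv h) (deriv (deriv h) z) z :=
      ((hh.analyticAt (Metric.isOpen_ball.mem_nhds hzball)).deriv).differentiableAt.hasDerivAt
    have h1 := (((hasDerivAt_pow (n - 1) z).const_mul (n : ℂ)).mul hhd).add
      ((hasDerivAt_pow n z).mul hhdd)
    refine h1.congr_of_eventuallyEq ?_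
    filter_upwards [Metric.isOpen_ball.mem_nhds hzball] with y hy using (hderiv y hy).deriv
  have hn1 : ((n - 1 : ℕ) : ℂ) = n - 1 := by
    rw [Nat.cast_sub hn, Nat.cast_one]
  have e1 : z * deriv f z - n * f z = z ^ n * z * deriv h z := by
    rw [(hderiv z hzball).deriv, (hfh z hzball).1]
    linear_combination h z * aux n z
  have e2 : z ^ 2 * deriv (deriv f) z - n * (n - 1) * f z
      = 2 * n * (z ^ n * z * deriv h z) + z ^ n * z ^ 2 * deriv (deriv h) z := by
    have a1 := aux (n - 1) z
    have a2 := aux n z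
    rw [hderiv2.deriv, (hfh z hzball).1, ← hn1]
    linear_combination n * z * h z * a1 + ((n - 1 : ℕ) * h z + 2 * z * deriv h z) * a2
  have b1 : ‖z ^ n * z * deriv h z‖ ≤ ‖z‖ ^ n * A * (4 * l) := by
    rw [norm_mul, norm_mul, norm_pow]
    calc ‖z‖ ^ n * ‖z‖ * ‖deriv h z‖ ≤ ‖z‖ ^ n * ‖z‖ * (4 * A / ρ) := by
          gcongr
          exact hd1 z hzl.le
      _ = ‖z‖ ^ n * A * (4 * l) := by rw [hl]; ring
  have b2 : ‖z ^ n * z ^ 2 * deriv (deriv h) z‖ ≤ ‖z‖ ^ n * A * l := by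
    rw [norm_mul, norm_mul, norm_pow, norm_pow]
    calc ‖z‖ ^ n * ‖z‖ ^ 2 * ‖deriv (deriv h) z‖ ≤ ‖z‖ ^ n * ‖z‖ ^ 2 * (16 * A / ρ ^ 2) := by
          gcongr
      _ = ‖z‖ ^ n * A * (16 * l * l) := by rw [hl]; field_simp
      _ ≤ ‖z‖ ^ n * A * (1 * l) := by gcongr; linarith
      _ = ‖z‖ ^ n * A * l := by ring
  refine ⟨?_, ?_, ?_⟩
  · rw [← norm_pos_iff]
    have : 0 < ‖z‖ ^ n * A := by positivity
    linarith
  · rw [e1]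
    nlinarith
  · rw [e2]
    refine (norm_add_le _ _).trans ?_
    rw [norm_mul, norm_mul, Complex.norm_ofNat, Complex.norm_natCast]
    have b3 : 2 * (n : ℝ) * ‖z ^ n * z * deriv h z‖ ≤ 2 * n * (‖z‖ ^ n * A * (4 * l)) := by gcongr
    have hn0 : (0 : ℝ) ≤ n := Nat.cast_nonneg n
    have b4 : ‖z‖ ^ n * A * ((8 * n + 1) * l) ≤ 2 * ‖f z‖ * ((8 * n + 1) * l) := by gcongr
    have b5 : 0 ≤ l * ‖f z‖ := by positivity
    nlinarith

/-! ### The theorem. -/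

theorem mainTheorem3 (n : ℕ) (hn : 1 ≤ n) :
    ∃ c C : ℝ, 0 < c ∧ c < 1 ∧ 0 < C ∧
      ∀ (r₀ : ℝ) (u : ℂ → ℝ), 0 < r₀ →
        InnerProductSpace.HarmonicOnNhd u (Metric.ball 0 r₀) →
        (¬ ∃ a : ℝ, ∀ z ∈ Metric.ball (0 : ℂ) r₀, u z = a) →
        (∃ g : ℂ → ℝ, HasL1BoundaryValue u g r₀) →
        u 0 = 0 →
        HasOnlyNodalCurvesThrough u (Metric.ball 0 r₀) 0 n →
        ∀ z ∈ nodalSet u (Metric.ball 0 r₀) \ {0}, z ∈ Metric.ball (0 : ℂ) (c * r₀) →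
          (partialX u z, partialY u z) ≠ (0, 0) ∧
          |nodalCurvature u z| ≤ C / r₀ ∧
          ∀ (I : Set ℝ) (γ : ℝ → ℂ), IsNodalCurve u (Metric.ball 0 r₀) I γ →
            ∀ t ∈ I, γ t = z → |curveCurvature γ t| ≤ C / r₀ := by
  set K : ℝ := (4 * n + 1) * 4 ^ n with hKdef
  have hn1 : (1 : ℝ) ≤ n := by exact_mod_cast hn
  have hK1 : 1 ≤ K := by
    have : (1 : ℝ) ≤ 4 ^ n := one_le_pow₀ (by norm_num)
    nlinarith
  have hK0 : 0 < K := by linarith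
  set C₀ : ℝ := 8 * ((16 * n + 4) * (n + 1) ^ 2 + 8 * n ^ 2 * (2 * n + 1)) with hC₀
  have hC₀0 : 0 < C₀ := by positivity
  -- With `ρ = R / (2 * K)`, the radius `R / (32 * K)` is `ρ / 16`, the range of the monomial
  -- comparison, and `C₀ / ρ` is `C₀ * (2 * K) / R`.
  refine ⟨1 / (32 * K), C₀ * (2 * K), by positivity, ?_, by positivity, ?_⟩
  · rw [div_lt_one (by positivity)]
    linarith
  rintro R u hR hharm hnconst ⟨g, hbv⟩ hu0 hcurves z ⟨⟨hzR, hzu⟩, hz0⟩ hzc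
  have hz0' : z ≠ 0 := hz0
  obtain ⟨F, hF, hFu⟩ := hharm.exists_analyticOnNhd_ball_re_eq
  -- Because `u 0 = 0`, the number `F 0` is purely imaginary and its removal leaves the real part
  -- unchanged.
  set f : ℂ → ℂ := fun z => F z - F 0 with hfdef
  have h0mem : (0 : ℂ) ∈ Metric.ball (0 : ℂ) R := Metric.mem_ball_self hR
  have hf : AnalyticOnNhd ℂ f (Metric.ball 0 R) := hF.sub analyticOnNhd_const
  have hu : ∀ z ∈ Metric.ball 0 R, (f z).re = u z := fun z hz => by
    have e1 : (F z).re = u z := hFu hz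
    have e2 : (F 0).re = u 0 := hFu h0mem
    rw [hfdef, Complex.sub_re, e1, e2, hu0, sub_zero]
  have hf0 : f 0 = 0 := sub_self _
  have hnc : ¬ ∃ a, ∀ z ∈ Metric.ball (0 : ℂ) R, f z = a := by
    rintro ⟨a, ha⟩
    exact hnconst ⟨a.re, fun z hz => by rw [← hu z hz, ha z hz]⟩
  obtain ⟨hlow, hbd⟩ := taylorCoeff_bounds hbv hR hharm hf hu hf0 hnc hcurves
  obtain ⟨h, hh, hh0, hfh⟩ := exists_eq_pow_mul_of_taylorCoeff_le hR hK1 hf.differentiableOn hlow hbd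
  -- If the `n`-th coefficient vanished, the bound on `h` would make `f` zero near `0`, hence
  -- constant.
  have hA : 0 < ‖taylorCoeff f n‖ := by
    rw [norm_pos_iff]
    intro h0
    refine not_eventually_eq_of_not_const hf hnc h0mem ?_
    filter_upwards [Metric.ball_mem_nhds (0 : ℂ) (show 0 < R / (2 * K) by positivity)] with w hw
    have h1 := (hfh w hw).2
    rw [h0, norm_zero, mul_zero, norm_le_zero_iff] at h1
    rw [(hfh w hw).1, h1, mul_zero, hf0]
  have hl : ‖z‖ / (R / (2 * K)) ≤ 1 / 16 := by
    have h1 : ‖z‖ < 1 / (32 * K) * R := by simpa using hzc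
    rw [div_le_iff₀ (by positivity)]
    refine h1.le.trans_eq ?_
    field_simp
    norm_num
  obtain ⟨hw0, h₁, h₂⟩ := pow_mul_derivative_bounds hn (by positivity) hA hh (by rw [hh0]) hfh hz0' hl
  obtain ⟨hd, hκ⟩ := abs_re_mul_conj_sq_le hn ((hu z hzR).trans hzu) hw0 hz0' (by positivity) hl h₁ h₂
  have hκ' : |nodalCurvature u z| ≤ C₀ * (2 * K) / R := by
    rw [nodalCurvature_eq Metric.isOpen_ball hf hu hzR, abs_div,
      abs_of_nonneg (pow_nonneg (norm_nonneg _) 3)]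
    refine hκ.trans_eq ?_
    have : ‖z‖ ≠ 0 := norm_ne_zero_iff.mpr hz0'
    rw [← hC₀]
    field_simp
  refine ⟨fun hgrad => hd ?_, hκ', ?_⟩
  · rw [Prod.mk.injEq, partialX_eq Metric.isOpen_ball hf hu hzR,
      partialY_eq Metric.isOpen_ball hf hu hzR] at hgrad
    refine Complex.ext hgrad.1 ?_
    simpa using hgrad.2
  · rintro I γ hγ t ht rfl
    rw [hγ.toIsNodalArc.abs_curveCurvature_eq Metric.isOpen_ball hf hu ht hd]
    exact hκ'
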